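/- Let $K\subseteq\mathbb{R}^n$ be a convex body with $K=-K$ which is in John's position, i.e. the Euclidean unit ball $B_2^n$ is contained in $K$ and has maximal volume among all ellipsoids contained in $K$. Let $\mathrm{Id}_n=\sum_{j=1}^m c_j\,v_j\otimes v_j$ be a decomposition of the identity associated to $K$, i.e. $v_1,\dots,v_m\in\partial K\cap S^{n-1}$ and $c_1,\dots,c_m>0$ (here $(v\otimes v)x=\langle v,x\rangle v$). Let $H\subseteq\mathbb{R}^n$ be a $k$-dimensional linear subspace, $P_H$ the orthogonal projection onto $H$, $J=\{1\le j\le m: P_Hv_j\ne 0\}$ and $m_0=\#J$. For $j\in J$ put $$\tilde c_j=c_j\|P_Hv_j\|_2^2\in(0,1],\qquad p_j=\frac{1}{1-\tilde c_j}\in(1,\infty],\qquad t_j=\frac{1}{\|P_Hv_j\|_2},$$ and for $1<p<\infty$ let $I_p=\int_{\mathbb{R}}\left|\frac{\sin x}{x}\right|^p dx$. Then $$\mathrm{vol}_k(K\cap H)\le\frac{2^k}{\pi^{m_0-k}}\prod_{j\in J}\left((1-\tilde c_j)^{-1/(2p_j)}\,I_{p_j}^{1/p_j}\,\big(\sqrt{\tilde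 c_j}\,t_j\big)^{\tilde c_j}\right),$$ where, if $\tilde c_j=1$ (so $p_j=\infty$), the quantity $(1-\tilde c_j)^{-1/(2p_j)}I_{p_j}^{1/p_j}$ is read as its limiting value $1$. In particular, if $\tilde c_j\ge\frac12$ for every $j\in J$, then $$\mathrm{vol}_k(K\cap H)\le 2^{\frac{m_0+k}{2}}\prod_{j\in J}c_j^{\frac{c_j\|P_Hv_j\|_2^2}{2}}.$$ -/

import Mathlib

open MeasureTheory

namespace JohnSection

/-- The Euclidean space `ℝⁿ`. -/
abbrev Rn (n : ℕ) : Type := EuclideanSpace ℝ (Fin n)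

/-- A nondegenerate (solid) ellipsoid: the image of the closed unit ball under an invertible affine
map `x ↦ A x + b`. -/
def IsEllipsoid {n : ℕ} (E : Set (Rn n)) : Prop :=
  ∃ (A : Rn n ≃ₗ[ℝ] Rn n) (b : Rn n), E = (fun x => A x + b) '' Metric.closedBall (0 : Rn n) 1

/-- `K` is in John's position: the Euclidean unit ball is contained in `K` and has the largest
volume among all ellipsoids contained in `K`. -/
structure IsJohnPosition {n : ℕ} (K : ConvexBody (Rn n)) : Prop where
  ball_subset : Metric.closedBall (0 : Rn n) 1 ⊆ (K : Set (Rn n))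
  volume_le : ∀ E : Set (Rn n), IsEllipsoid E → E ⊆ (K : Set (Rn n)) →
    volume E ≤ volume (Metric.closedBall (0 : Rn n) 1)

/-- `(c_j, v_j)` is a decomposition of the identity associated to `K`: the `v_j` are contact points
of `K` with the unit sphere, the `c_j` are positive, and `Id = ∑ c_j v_j ⊗ v_j`. -/
structure IsJohnDecomposition {n m : ℕ} (K : ConvexBody (Rn n))
    (c : Fin m → ℝ) (v : Fin m → Rn n) : Prop where
  contact : ∀ j, v j ∈ frontier (K : Set (Rn n)) ∩ Metric.sphere (0 : Rn n) 1
  pos : ∀ j, 0 < c j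
  identity : ∀ x : Rn n, ∑ j, c j • inner ℝ (v j) x • v j = x

/-- `I_p = ∫_ℝ |sin x / x|^p dx`. -/
noncomputable def sincIntegral (p : ℝ) : ℝ := ∫ x : ℝ, |Real.sin x / x| ^ p

/-- `J = {j : P_H v_j ≠ 0}`. -/
noncomputable def activeIndices {n m : ℕ} (H : Submodule ℝ (Rn n)) (v : Fin m → Rn n) :
    Finset (Fin m) :=
  open Classical in Finset.univ.filter fun j => H.starProjection (v j) ≠ 0

/-- `c̃_j = c_j ‖P_H v_j‖²`. -/
noncomputable def cTilde {n m : ℕ} (H : Submodule ℝ (Rn n)) (c : Fin m → ℝ) (v : Fin m → Rn n)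
    (j : Fin m) : ℝ :=
  c j * ‖H.starProjection (v j)‖ ^ 2

/-- `t_j = 1 / ‖P_H v_j‖`. -/
noncomputable def tInv {n m : ℕ} (H : Submodule ℝ (Rn n)) (v : Fin m → Rn n) (j : Fin m) : ℝ :=
  1 / ‖H.starProjection (v j)‖

/-- `(1 - a)^{-1/(2p)} I_p^{1/p}` with `p = 1/(1 - a)`. At `a = 1`, that is `p = ∞`, it is the
limiting value `1` (the supremum of `|sin x / x|`). -/
noncomputable def sincFactor (a : ℝ) : ℝ :=
  open Classical in
  if a = 1 then 1
  else
    let p : ℝ := 1 / (1 - a)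
    (1 - a) ^ (-(1 / (2 * p))) * sincIntegral p ^ (1 / p)

end JohnSection

/-! At a contact point `v j` the supporting hyperplane of K also supports the ball, so it is
orthogonal to `v j`, and by symmetry K lies in the slab |⟨v j, x⟩| ≤ 1. The vectors w j = √(c j) P_H
(v j), j ∈ J, form a Parseval frame of H with ‖w j‖² = c̃ j. Hence x ↦ (⟨w j, x⟩) embeds H
isometrically onto a subspace S of ℝ^J and carries K ∩ H into the section by S of the box with
half-sides a j = √(c j).

The volumes of the sections parallel to S form a function on Sᗮ whose Fourier transform is the
restriction to Sᗮ of ∏ 2 a j sinc(2π a j y j). Fourier inversion at 0 bounds the central section by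
the integral of the absolute value of this product (`BoxSection.volume_section_le`). The projections
of the basis vectors to Sᗮ have squared norms 1 - c̃ j = 1 / p j and resolve the identity there, so
the geometric Brascamp-Lieb inequality (`BrascampLieb.lintegral_prod_rpow_le`, by Barthe's transport
argument) bounds that integral by one-dimensional integrals I_p.

If c̃ j ≥ 1/2, then p j ≥ 2 and Ball's inequality I_p ≤ π √(2/p) applies
(`BallIntegral.integral_abs_sinc_rpow_le`). It is proved by the distribution function method of
Nazarov and Podkorytov: |sinc| and a Gaussian have the same L² norm, and their distribution
functions cross at most once. -/

namespace BrascampLieb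

open Set Filter Topology

/-! ### Monotone transport on the line -/

section Transport

lemma cdf_eq {f : ℝ → ℝ} (hi : Integrable f) (t : ℝ) :
    ∫ x in Iic t, f x = (∫ x in Iic 0, f x) + ∫ x in (0 : ℝ)..t, f x := by
  rw [← intervalIntegral.integral_Iic_sub_Iic hi.integrableOn hi.integrableOn]
  ring

/-- The strict derivative is what the inverse function theorem in `exists_transport` requires. -/
lemma hasStrictDerivAt_cdf {f : ℝ → ℝ} (hf : Continuous f) (hi : Integrable f) (t : ℝ) :
    HasStrictDerivAt (fun t => ∫ x in Iic t, f x) (f t) t := by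
  have h := (intervalIntegral.integral_hasStrictDerivAt_right (a := 0) (b := t)
    (hf.intervalIntegrable _ _) (hf.stronglyMeasurableAtFilter _ _) hf.continuousAt)
  have h2 := h.const_add (∫ x in Iic 0, f x)
  exact h2.congr_of_eventuallyEq (Eventually.of_forall fun t => (cdf_eq hi t).symm)

lemma strictMono_cdf {f : ℝ → ℝ} (hf : Continuous f) (hi : Integrable f) (hp : ∀ x, 0 < f x) :
    StrictMono (fun t => ∫ x in Iic t, f x) :=
  strictMono_of_deriv_pos fun t => by
    rw [(hasStrictDerivAt_cdf hf hi t).hasDerivAt.deriv]; exact hp t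

lemma continuous_cdf {f : ℝ → ℝ} (hf : Continuous f) (hi : Integrable f) :
    Continuous (fun t => ∫ x in Iic t, f x) :=
  continuous_iff_continuousAt.2 fun t => (hasStrictDerivAt_cdf hf hi t).hasDerivAt.continuousAt

lemma tendsto_cdf_atTop {f : ℝ → ℝ} (hi : Integrable f) :
    Tendsto (fun t => ∫ x in Iic t, f x) atTop (𝓝 (∫ x, f x)) :=
  (aecover_Iic tendsto_id).integral_tendsto_of_countably_generated hi

lemma tendsto_cdf_atBot {f : ℝ → ℝ} (hi : Integrable f) :
    Tendsto (fun t => ∫ x in Iic t, f x) atBot (𝓝 0) := by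
  have h := (aecover_Ioi (μ := volume) (tendsto_id (α := ℝ) (x := atBot))).integral_tendsto_of_countably_generated
    hi
  have h2 := h.const_sub (∫ x, f x)
  rw [sub_self] at h2
  refine h2.congr fun t => ?_
  rw [← intervalIntegral.integral_Iic_add_Ioi (b := t) hi.integrableOn hi.integrableOn]
  simp

lemma exists_cdf_eq {f g : ℝ → ℝ} (hf : Continuous f) (hfi : Integrable f) (hfp : ∀ x, 0 < f x)
    (hg : Continuous g) (hgi : Integrable g) (h : ∫ x, f x = ∫ x, g x) (t : ℝ) :
    ∃ s, ∫ x in Iic s, g x = ∫ x in Iic t, f x := by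
  have hm := strictMono_cdf hf hfi hfp
  have h0 : 0 < ∫ x in Iic t, f x := by
    refine lt_of_le_of_lt ?_ (hm (sub_one_lt t))
    exact integral_nonneg fun x => (hfp x).le
  have h1 : ∫ x in Iic t, f x < ∫ x, f x := by
    refine lt_of_lt_of_le (hm (lt_add_one t)) ?_
    exact setIntegral_le_integral hfi (Eventually.of_forall fun x => (hfp x).le)
  rw [h] at h1
  exact mem_range_of_exists_le_of_exists_ge (continuous_cdf hg hgi)
    ((tendsto_cdf_atBot hgi).eventually (eventually_le_nhds h0)).exists
    ((tendsto_cdf_atTop hgi).eventually (eventually_ge_nhds h1)).exists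

/-- The monotone transport map between two positive continuous densities of equal mass. -/
lemma exists_transport {f g : ℝ → ℝ} (hf : Continuous f) (hfi : Integrable f) (hfp : ∀ x, 0 < f x)
    (hg : Continuous g) (hgi : Integrable g) (hgp : ∀ x, 0 < g x)
    (h : ∫ x, f x = ∫ x, g x) :
    ∃ T : ℝ → ℝ, StrictMono T ∧ ∀ t, HasDerivAt T (f t / g (T t)) t := by
  choose T hT using exists_cdf_eq hf hfi hfp hg hgi h
  have hmf := strictMono_cdf hf hfi hfp
  have hmg := strictMono_cdf hg hgi hgp
  have hmono : StrictMono T := fun a b hab => by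
    have := hmf hab
    simp only [← hT] at this
    exact hmg.lt_iff_lt.1 this
  have hsurj : Function.Surjective T := fun s => by
    obtain ⟨t, ht⟩ := exists_cdf_eq hg hgi hgp hf hfi h.symm s
    exact ⟨t, hmg.injective (by simpa [hT] using ht)⟩
  -- A monotone surjection is continuous; so T x stays near T t, where T can be identified with the
  -- local inverse of the primitive of g applied to that of f.
  have hcont : Continuous T := hmono.monotone.continuous_of_surjective hsurj
  refine ⟨T, hmono, fun t => ?_⟩
  have hd := hasStrictDerivAt_cdf hg hgi (T t)
  have hL := (hd.to_localInverse (hgp _).ne').hasDerivAt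
  have hev := hd.hasStrictFDerivAt_equiv (hgp _).ne' |>.eventually_left_inverse
  have hev' := hcont.continuousAt.eventually hev
  simp only [hT] at hL
  have hc := hL.comp t (hasStrictDerivAt_cdf hf hfi t).hasDerivAt
  rw [div_eq_inv_mul]
  refine hc.congr_of_eventuallyEq ?_
  filter_upwards [hev'] with x hx
  simp only [Function.comp, ← hT x]
  exact hx.symm

end Transport

/-! ### A determinant inequality for frame operators -/

section Det

variable {U ι : Type*} [NormedAddCommGroup U] [InnerProductSpace ℝ U] [Fintype ι]

/-- The operator `∑ j, a j • u j ⊗ u j`. -/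
noncomputable def frameOp (a : ι → ℝ) (u : ι → U) : U →L[ℝ] U :=
  ∑ j, a j • (innerSL ℝ (u j)).smulRight (u j)

lemma frameOp_apply (a : ι → ℝ) (u : ι → U) (x : U) :
    frameOp a u x = ∑ j, (a j * inner ℝ (u j) x) • u j := by
  simp [frameOp, smul_smul]

/-- In an eigenbasis e, each eigenvalue is the mean of the `l j` with weights d j ⟨u j, e i⟩². These
sum to 1 over j by `hid` and to `d j` over i by `hu`, so weighted AM-GM for each eigenvalue,
multiplied over i, gives the claim. The form of `hu` leaves `u j` free when `d j = 0`. -/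
lemma prod_rpow_le_det_frameOp [FiniteDimensional ℝ U] {d l : ι → ℝ} {u : ι → U} (hd : ∀ j, 0 ≤ d j)
    (hu : ∀ j, d j * ‖u j‖ ^ 2 = d j) (hid : ∀ x, ∑ j, (d j * inner ℝ (u j) x) • u j = x)
    (hl : ∀ j, 0 < l j) :
    ∏ j, l j ^ d j ≤ (frameOp (fun j => d j * l j) u).det := by
  set A : U →ₗ[ℝ] U := (frameOp (fun j => d j * l j) u).toLinearMap with hA
  have hsymm : A.IsSymmetric := fun x y => by
    simp only [hA, ContinuousLinearMap.coe_coe, frameOp_apply, sum_inner, inner_sum,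
      inner_smul_left, inner_smul_right]
    refine Finset.sum_congr rfl fun j _ => ?_
    simp only [conj_trivial]
    rw [real_inner_comm x (u j)]
    ring
  have hdet : (frameOp (fun j => d j * l j) u).det = A.det := rfl
  rw [hdet, hsymm.det_eq_prod_eigenvalues rfl]
  set e := hsymm.eigenvectorBasis rfl
  have hev : ∀ i, hsymm.eigenvalues rfl i = ∑ j, (d j * inner ℝ (u j) (e i) ^ 2) * l j := by
    intro i
    have h1 : inner ℝ (A (e i)) (e i) = hsymm.eigenvalues rfl i := by
      rw [hsymm.apply_eigenvectorBasis]
      simp [inner_smul_left, e]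
    rw [← h1]
    simp only [hA, ContinuousLinearMap.coe_coe, frameOp_apply, sum_inner, inner_smul_left]
    refine Finset.sum_congr rfl fun j _ => ?_
    simp only [conj_trivial]
    ring
  have hw : ∀ i, ∑ j, d j * inner ℝ (u j) (e i) ^ 2 = 1 := by
    intro i
    have h1 : inner ℝ (∑ j, (d j * inner ℝ (u j) (e i)) • u j) (e i) = (1 : ℝ) := by
      rw [hid]; simp
    rw [← h1]
    simp only [sum_inner, inner_smul_left]
    refine Finset.sum_congr rfl fun j _ => ?_
    simp only [conj_trivial]
    ring
  have hs : ∀ j, ∑ i, d j * inner ℝ (u j) (e i) ^ 2 = d j := by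
    intro j
    rw [← Finset.mul_sum, e.sum_sq_inner_left, hu]
  calc ∏ j, l j ^ d j = ∏ j, ∏ i, l j ^ (d j * inner ℝ (u j) (e i) ^ 2) := by
        refine Finset.prod_congr rfl fun j _ => ?_
        rw [← Real.rpow_sum_of_pos (hl j), hs]
    _ = ∏ i, ∏ j, l j ^ (d j * inner ℝ (u j) (e i) ^ 2) := Finset.prod_comm
    _ ≤ ∏ i, hsymm.eigenvalues rfl i := by
        refine Finset.prod_le_prod (fun i _ => Finset.prod_nonneg fun j _ =>
          Real.rpow_nonneg (hl j).le _) fun i _ => ?_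
        rw [hev]
        exact Real.geom_mean_le_arith_mean_weighted _ _ _
          (fun j _ => mul_nonneg (hd j) (sq_nonneg _)) (hw i) (fun j _ => (hl j).le)
    _ = _ := by simp

end Det

/-! ### The geometric Brascamp-Lieb inequality -/

section Inequality

variable {U ι : Type*} [NormedAddCommGroup U] [InnerProductSpace ℝ U] [Fintype ι]

lemma sum_mul_inner_sq {d : ι → ℝ} {u : ι → U}
    (hid : ∀ x, ∑ j, (d j * inner ℝ (u j) x) • u j = x) (x : U) :
    ∑ j, d j * inner ℝ (u j) x ^ 2 = ‖x‖ ^ 2 := by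
  rw [← real_inner_self_eq_norm_sq]
  nth_rw 2 [← hid x]
  simp only [sum_inner, inner_smul_left, conj_trivial]
  exact Finset.sum_congr rfl fun j _ => by ring

/-- The map s ↦ ∑ d j s j u j is the adjoint of the isometry x ↦ (⟨u j, x⟩) into ℓ² with weights d,
hence a contraction. -/
lemma norm_sq_sum_le {d : ι → ℝ} {u : ι → U} (hd : ∀ j, 0 ≤ d j)
    (hid : ∀ x, ∑ j, (d j * inner ℝ (u j) x) • u j = x) (s : ι → ℝ) :
    ‖∑ j, (d j * s j) • u j‖ ^ 2 ≤ ∑ j, d j * s j ^ 2 := by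
  set y := ∑ j, (d j * s j) • u j with hy
  have h1 : ‖y‖ ^ 2 = ∑ j, d j * s j * inner ℝ (u j) y := by
    rw [← real_inner_self_eq_norm_sq]
    nth_rw 1 [hy]
    simp only [sum_inner, inner_smul_left, conj_trivial]
  have h2 : ∑ j, d j * s j * inner ℝ (u j) y ≤
      ∑ j, (d j * s j ^ 2 + d j * inner ℝ (u j) y ^ 2) / 2 :=
    Finset.sum_le_sum fun j _ => by
      nlinarith [mul_nonneg (hd j) (sq_nonneg (s j - inner ℝ (u j) y))]
  rw [← Finset.sum_div, Finset.sum_add_distrib, sum_mul_inner_sq hid] at h2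
  linarith

lemma integral_gaussian_pi : ∫ x : ℝ, Real.exp (-Real.pi * x ^ 2) = 1 := by
  rw [integral_gaussian, div_self Real.pi_ne_zero, Real.sqrt_one]

variable [FiniteDimensional ℝ U] [MeasurableSpace U] [BorelSpace U]

lemma lintegral_gaussian_pi :
    ∫⁻ x : U, ENNReal.ofReal (Real.exp (-Real.pi * ‖x‖ ^ 2)) = 1 := by
  have h := GaussianFourier.integral_rexp_neg_mul_sq_norm (V := U) Real.pi_pos
  rw [div_self Real.pi_ne_zero, Real.one_rpow] at h
  rw [← ofReal_integral_eq_lintegral_ofReal, h, ENNReal.ofReal_one]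
  · by_contra hn
    rw [integral_undef hn] at h
    exact zero_ne_one h
  · exact Filter.Eventually.of_forall fun x => (Real.exp_pos _).le

/-- Let T j transport f j to I j times the Gaussian exp(-π t²), and put Θ x = ∑ d j T j(⟨u j, x⟩) u
j. The determinant inequality bounds det DΘ below by ∏ (T j')^(d j), and `norm_sq_sum_le` bounds the
Gaussian at Θ x below by the product of the one-dimensional ones. So the integrand is at most ∏ I
j^(d j) times the pulled-back Gaussian density, whose mass is at most 1 because Θ is injective. -/
lemma lintegral_prod_rpow_le_of_pos {d : ι → ℝ} {u : ι → U} (hd : ∀ j, 0 ≤ d j)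
    (hu : ∀ j, d j * ‖u j‖ ^ 2 = d j) (hid : ∀ x, ∑ j, (d j * inner ℝ (u j) x) • u j = x)
    {f : ι → ℝ → ℝ} (hf : ∀ j, Continuous (f j)) (hfi : ∀ j, Integrable (f j))
    (hfp : ∀ j x, 0 < f j x) :
    ∫⁻ x : U, ENNReal.ofReal (∏ j, f j (inner ℝ (u j) x) ^ d j) ≤
      ENNReal.ofReal (∏ j, (∫ t, f j t) ^ d j) := by
  set g : ℝ → ℝ := fun t => Real.exp (-Real.pi * t ^ 2) with hg
  have hgp : ∀ t, 0 < g t := fun t => Real.exp_pos _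
  have hgi : Integrable g := integrable_exp_neg_mul_sq Real.pi_pos
  set I : ι → ℝ := fun j => ∫ t, f j t with hI
  have hIp : ∀ j, 0 < I j := fun j => by
    rw [hI, integral_pos_iff_support_of_nonneg (fun x => (hfp j x).le) (hfi j)]
    have : Function.support (f j) = univ := eq_univ_of_forall fun x => (hfp j x).ne'
    simp [this]
  have hT : ∀ j, ∃ T : ℝ → ℝ, StrictMono T ∧ ∀ t, HasDerivAt T (f j t / (I j * g (T t))) t := by
    intro j
    refine exists_transport (g := fun t => I j * g t) (hf j) (hfi j) (hfp j) (by fun_prop)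
      (hgi.const_mul _) (fun t => mul_pos (hIp j) (hgp t)) ?_
    rw [integral_const_mul, integral_gaussian_pi, mul_one]
  choose T hTm hTd using hT
  set l : ι → ℝ → ℝ := fun j t => f j t / (I j * g (T j t)) with hl
  have hlp : ∀ j t, 0 < l j t := fun j t => div_pos (hfp j t) (mul_pos (hIp j) (hgp _))
  set Θ : U → U := fun x => ∑ j, (d j * T j (inner ℝ (u j) x)) • u j with hΘ
  set D : U → U →L[ℝ] U := fun x => frameOp (fun j => d j * l j (inner ℝ (u j) x)) u with hD
  have hder : ∀ x, HasFDerivAt Θ (D x) x := by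
    intro x
    simp only [hΘ, hD, frameOp]
    refine HasFDerivAt.fun_sum fun j _ => ?_
    have h1 : HasFDerivAt (fun x => inner ℝ (u j) x) (innerSL ℝ (u j)) x :=
      (innerSL ℝ (u j)).hasFDerivAt
    have h2 := (((hTd j (inner ℝ (u j) x)).comp_hasFDerivAt x h1).const_mul (d j)).smul_const (u j)
    refine h2.congr_fderiv ?_
    ext y
    simp [smul_smul, hl]
  -- ⟨Θ x - Θ y, x - y⟩ is a sum of nonnegative terms; if it vanishes, ⟨u j, x⟩ = ⟨u j, y⟩ wherever
  -- d j ≠ 0, and `hid` recovers x = y.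
  have hinj : Function.Injective Θ := by
    intro x y hxy
    have h0 : inner ℝ (Θ x - Θ y) (x - y) = (0 : ℝ) := by rw [hxy, sub_self, inner_zero_left]
    have h1 : inner ℝ (Θ x - Θ y) (x - y) = ∑ j, d j * ((T j (inner ℝ (u j) x) -
        T j (inner ℝ (u j) y)) * (inner ℝ (u j) x - inner ℝ (u j) y)) := by
      simp only [hΘ, ← Finset.sum_sub_distrib, ← sub_smul, sum_inner, inner_smul_left,
        conj_trivial, inner_sub_right]
      exact Finset.sum_congr rfl fun j _ => by ring
    have hnn : ∀ j, 0 ≤ (T j (inner ℝ (u j) x) - T j (inner ℝ (u j) y)) *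
        (inner ℝ (u j) x - inner ℝ (u j) y) := fun j => by
      rcases le_total (inner ℝ (u j) x) (inner ℝ (u j) y) with h | h
      · exact mul_nonneg_of_nonpos_of_nonpos (sub_nonpos.2 ((hTm j).monotone h)) (sub_nonpos.2 h)
      · exact mul_nonneg (sub_nonneg.2 ((hTm j).monotone h)) (sub_nonneg.2 h)
    rw [h0, eq_comm, Finset.sum_eq_zero_iff_of_nonneg fun j _ => mul_nonneg (hd j) (hnn j)] at h1
    rw [← sub_eq_zero, ← hid (x - y)]
    refine Finset.sum_eq_zero fun j hj => ?_
    have := h1 j hj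
    rcases mul_eq_zero.1 this with h | h
    · simp [h]
    · have h2 : inner ℝ (u j) x = inner ℝ (u j) y := by
        rcases mul_eq_zero.1 h with h | h
        · exact (hTm j).injective (sub_eq_zero.1 h)
        · exact sub_eq_zero.1 h
      simp [inner_sub_right, h2]
  have hcv := lintegral_image_eq_lintegral_abs_det_fderiv_mul (volume : Measure U)
    MeasurableSet.univ (fun x _ => (hder x).hasFDerivWithinAt) hinj.injOn
    (fun y => ENNReal.ofReal (Real.exp (-Real.pi * ‖y‖ ^ 2)))
  have hle1 : ∫⁻ x : U, ENNReal.ofReal |(D x).det| *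
      ENNReal.ofReal (Real.exp (-Real.pi * ‖Θ x‖ ^ 2)) ≤ 1 := by
    rw [← setLIntegral_univ, ← hcv, ← lintegral_gaussian_pi (U := U)]
    exact setLIntegral_le_lintegral _ _
  have hpt : ∀ x, ∏ j, f j (inner ℝ (u j) x) ^ d j ≤
      (∏ j, I j ^ d j) * (|(D x).det| * Real.exp (-Real.pi * ‖Θ x‖ ^ 2)) := by
    intro x
    have h1 : ∀ j, f j (inner ℝ (u j) x) ^ d j = I j ^ d j *
        (l j (inner ℝ (u j) x) ^ d j *
          Real.exp (-Real.pi * (d j * T j (inner ℝ (u j) x) ^ 2))) := by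
      intro j
      have h2 : f j (inner ℝ (u j) x) = I j * (l j (inner ℝ (u j) x) *
          g (T j (inner ℝ (u j) x))) := by
        simp only [hl]
        have := (hIp j).ne'
        have := (hgp (T j (inner ℝ (u j) x))).ne'
        field_simp
      rw [h2, Real.mul_rpow (hIp j).le (mul_pos (hlp j _) (hgp _)).le,
        Real.mul_rpow (hlp j _).le (hgp _).le, hg, ← Real.exp_mul]
      congr 3
      ring
    simp_rw [h1]
    rw [Finset.prod_mul_distrib, Finset.prod_mul_distrib, ← Real.exp_sum, ← Finset.mul_sum]
    refine mul_le_mul_of_nonneg_left ?_ (Finset.prod_nonneg fun j _ =>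
      Real.rpow_nonneg (hIp j).le _)
    refine mul_le_mul ?_ ?_ (Real.exp_pos _).le (abs_nonneg _)
    · exact (prod_rpow_le_det_frameOp hd hu hid fun j => hlp j _).trans (le_abs_self _)
    · refine Real.exp_le_exp.2 ?_
      have := norm_sq_sum_le hd hid fun j => T j (inner ℝ (u j) x)
      nlinarith [Real.pi_pos]
  have hIn : 0 ≤ ∏ j, I j ^ d j := Finset.prod_nonneg fun j _ => Real.rpow_nonneg (hIp j).le _
  calc ∫⁻ x : U, ENNReal.ofReal (∏ j, f j (inner ℝ (u j) x) ^ d j)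
      ≤ ∫⁻ x : U, ENNReal.ofReal (∏ j, I j ^ d j) * (ENNReal.ofReal |(D x).det| *
          ENNReal.ofReal (Real.exp (-Real.pi * ‖Θ x‖ ^ 2))) := by
        refine lintegral_mono fun x => ?_
        rw [← ENNReal.ofReal_mul (abs_nonneg _), ← ENNReal.ofReal_mul hIn]
        exact ENNReal.ofReal_le_ofReal (hpt x)
    _ = ENNReal.ofReal (∏ j, I j ^ d j) * ∫⁻ x : U, (ENNReal.ofReal |(D x).det| *
          ENNReal.ofReal (Real.exp (-Real.pi * ‖Θ x‖ ^ 2))) :=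
        lintegral_const_mul' _ _ ENNReal.ofReal_ne_top
    _ ≤ ENNReal.ofReal (∏ j, I j ^ d j) * 1 := by gcongr
    _ = _ := mul_one _

/-- The rank-one geometric Brascamp-Lieb inequality. -/
theorem lintegral_prod_rpow_le {d : ι → ℝ} {u : ι → U} (hd : ∀ j, 0 ≤ d j)
    (hu : ∀ j, d j * ‖u j‖ ^ 2 = d j) (hid : ∀ x, ∑ j, (d j * inner ℝ (u j) x) • u j = x)
    {f : ι → ℝ → ℝ} (hf : ∀ j, Continuous (f j)) (hfi : ∀ j, Integrable (f j))
    (hfp : ∀ j x, 0 ≤ f j x) :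
    ∫⁻ x : U, ENNReal.ofReal (∏ j, f j (inner ℝ (u j) x) ^ d j) ≤
      ENNReal.ofReal (∏ j, (∫ t, f j t) ^ d j) := by
  -- Adding ε times the Gaussian of mass 1 makes every density positive and raises its integral by
  -- exactly ε.
  have hlim : Tendsto (fun ε : ℝ => ENNReal.ofReal (∏ j, ((∫ t, f j t) + ε) ^ d j)) (𝓝[>] 0)
      (𝓝 (ENNReal.ofReal (∏ j, (∫ t, f j t) ^ d j))) := by
    refine tendsto_nhdsWithin_of_tendsto_nhds ?_
    refine (ENNReal.continuous_ofReal.tendsto _).comp ?_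
    refine tendsto_finsetProd _ fun j _ => ?_
    have h1 : Tendsto (fun ε : ℝ => (∫ t, f j t) + ε) (𝓝 0) (𝓝 (∫ t, f j t)) := by
      simpa using (continuous_const.add continuous_id).tendsto (x := (0 : ℝ))
        (f := fun ε : ℝ => (∫ t, f j t) + ε)
    exact h1.rpow_const (Or.inr (hd j))
  refine ge_of_tendsto hlim ?_
  filter_upwards [self_mem_nhdsWithin] with ε hε
  have hgi : Integrable (fun t : ℝ => Real.exp (-Real.pi * t ^ 2)) :=
    integrable_exp_neg_mul_sq Real.pi_pos
  have h := lintegral_prod_rpow_le_of_pos hd hu hid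
    (f := fun j t => f j t + ε * Real.exp (-Real.pi * t ^ 2))
    (fun j => by have := hf j; fun_prop) (fun j => (hfi j).add (hgi.const_mul ε))
    (fun j x => add_pos_of_nonneg_of_pos (hfp j x) (mul_pos hε (Real.exp_pos _)))
  refine (lintegral_mono fun x => ENNReal.ofReal_le_ofReal ?_).trans (h.trans_eq ?_)
  · refine Finset.prod_le_prod (fun j _ => Real.rpow_nonneg (hfp j _) _) fun j _ => ?_
    refine Real.rpow_le_rpow (hfp j _) ?_ (hd j)
    exact le_add_of_nonneg_right (mul_pos hε (Real.exp_pos _)).le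
  · congr 1
    refine Finset.prod_congr rfl fun j _ => ?_
    rw [integral_add (hfi j) (hgi.const_mul ε), integral_const_mul, integral_gaussian_pi, mul_one]

end Inequality

end BrascampLieb

namespace BallIntegral

open Set Filter Topology Real

/-! ### Integrability of powers of sinc, and ∫ sinc² = π -/

section SquareIntegral

lemma abs_sinc_le_rpow (x : ℝ) : |sinc x| ≤ √2 * (1 + ‖x‖ ^ 2) ^ (-(1 / 2) : ℝ) := by
  have h1 : sinc x ^ 2 * (1 + x ^ 2) ≤ 2 := by
    have h2 : sinc x ^ 2 ≤ 1 := by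
      have := abs_sinc_le_one x
      rw [← sq_abs]; nlinarith [abs_nonneg (sinc x)]
    have h3 : sinc x ^ 2 * x ^ 2 ≤ 1 := by
      rcases eq_or_ne x 0 with rfl | hx
      · simp
      · rw [sinc_of_ne_zero hx, div_pow, div_mul_cancel₀ _ (pow_ne_zero 2 hx)]
        exact sin_sq_le_one x
    linarith
  have hp : 0 < 1 + x ^ 2 := by positivity
  rw [rpow_neg (by positivity), ← sqrt_eq_rpow, ← div_eq_mul_inv, ← sqrt_div (by norm_num),
    norm_eq_abs, sq_abs]
  refine abs_le_sqrt ?_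
  rwa [le_div_iff₀ hp]

lemma integrable_abs_sinc_rpow {p : ℝ} (hp : 1 < p) : Integrable fun x => |sinc x| ^ p := by
  have h : Integrable fun x : ℝ => √2 ^ p * (1 + ‖x‖ ^ 2) ^ (-p / 2) :=
    (integrable_rpow_neg_one_add_norm_sq (by simpa using hp)).const_mul _
  refine h.mono' ?_ (Eventually.of_forall fun x => ?_)
  · exact (continuous_sinc.abs.rpow_const fun _ => Or.inr (by linarith)).aestronglyMeasurable
  · rw [norm_of_nonneg (by positivity)]
    refine (rpow_le_rpow (abs_nonneg _) (abs_sinc_le_rpow x) (by linarith)).trans_eq ?_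
    rw [mul_rpow (by positivity) (by positivity), ← rpow_mul (by positivity)]
    congr 2
    ring

lemma integrable_sinc_sq : Integrable fun x => sinc x ^ 2 := by
  have := integrable_abs_sinc_rpow (p := 2) (by norm_num)
  simpa using this

/-- The triangle function on `[-1, 1]`. -/
noncomputable def triangle (x : ℝ) : ℂ := ((max 0 (1 - |x|) : ℝ) : ℂ)

lemma continuous_triangle : Continuous triangle := by unfold triangle; fun_prop

lemma triangle_eq_zero {x : ℝ} (hx : x ∉ Ioc (-1 : ℝ) 1) : triangle x = 0 := by
  have : 1 ≤ |x| := by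
    by_contra! h
    exact hx ⟨(abs_lt.1 h).1, (abs_lt.1 h).2.le⟩
  simp [triangle, this]

lemma integrable_triangle : Integrable triangle := by
  have h : IntegrableOn triangle (Ioc (-1) 1) :=
    (continuous_triangle.integrableOn_Icc (a := -1) (b := 1)).mono_set Ioc_subset_Icc_self
  exact (integrableOn_iff_integrable_of_support_subset fun x hx => by
    by_contra hx'; exact hx (triangle_eq_zero hx')).1 h

lemma integral_exp_mul_triangle {s : ℝ} (hs : s ≠ 0) :
    ∫ x, Complex.exp ((s * x : ℝ) * Complex.I) * triangle x = ((sinc (s / 2) ^ 2 : ℝ) : ℂ) := by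
  set z : ℂ := s * Complex.I with hz
  have hz0 : z ≠ 0 := by simp [hz, hs]
  have he : ∀ x : ℝ, HasDerivAt (fun x : ℝ => Complex.exp (z * x)) (z * Complex.exp (z * x)) x := by
    intro x
    have h1 : HasDerivAt (fun x : ℝ => z * (x : ℂ)) z x := by
      simpa using (Complex.ofRealCLM.hasDerivAt (x := x)).const_mul z
    simpa [mul_comm] using h1.cexp
  have hid : ∀ x : ℝ, HasDerivAt (fun x : ℝ => (x : ℂ)) 1 x := fun x =>
    (hasDerivAt_id x).ofReal_comp
  have hr : ∫ x in (0 : ℝ)..1, Complex.exp (z * x) * triangle x =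
      Complex.exp z / z ^ 2 - 1 / z - 1 / z ^ 2 := by
    have hd : ∀ x ∈ uIcc (0 : ℝ) 1, HasDerivAt (fun x : ℝ => (1 - (x : ℂ)) * Complex.exp (z * x) / z
        + Complex.exp (z * x) / z ^ 2) (Complex.exp (z * x) * triangle x) x := by
      intro x hx
      rw [uIcc_of_le zero_le_one] at hx
      have ht : triangle x = 1 - x := by
        simp [triangle, abs_of_nonneg hx.1, hx.2]
      have := ((((hid x).const_sub 1).mul (he x)).div_const z).add ((he x).div_const (z ^ 2))
      convert! this using 1
      rw [ht]
      field_simp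
      ring
    rw [intervalIntegral.integral_eq_sub_of_hasDerivAt hd
      (Continuous.intervalIntegrable (by have := continuous_triangle; fun_prop) _ _)]
    simp
    ring
  have hl : ∫ x in (-1 : ℝ)..0, Complex.exp (z * x) * triangle x =
      1 / z - 1 / z ^ 2 + Complex.exp (-z) / z ^ 2 := by
    have hd : ∀ x ∈ uIcc (-1 : ℝ) 0, HasDerivAt (fun x : ℝ => (1 + (x : ℂ)) * Complex.exp (z * x) / z
        - Complex.exp (z * x) / z ^ 2) (Complex.exp (z * x) * triangle x) x := by
      intro x hx
      rw [uIcc_of_le (by norm_num)] at hx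
      have ht : triangle x = 1 + x := by
        have : 0 ≤ 1 + x := by linarith [hx.1]
        simp [triangle, abs_of_nonpos hx.2, this]
      have := ((((hid x).const_add 1).mul (he x)).div_const z).sub ((he x).div_const (z ^ 2))
      convert! this using 1
      rw [ht]
      field_simp
      ring
    rw [intervalIntegral.integral_eq_sub_of_hasDerivAt hd
      (Continuous.intervalIntegrable (by have := continuous_triangle; fun_prop) _ _)]
    simp
  have h0 : ∫ x, Complex.exp ((s * x : ℝ) * Complex.I) * triangle x =
      ∫ x in (-1 : ℝ)..1, Complex.exp (z * x) * triangle x := by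
    rw [intervalIntegral.integral_of_le (by norm_num),
      ← setIntegral_eq_integral_of_forall_compl_eq_zero (s := Ioc (-1 : ℝ) 1)
        fun x hx => by rw [triangle_eq_zero hx, mul_zero]]
    refine integral_congr_ae (Eventually.of_forall fun x => ?_)
    simp only [hz]
    push_cast
    ring_nf
  rw [h0, ← intervalIntegral.integral_add_adjacent_intervals (b := 0)
    (Continuous.intervalIntegrable (by have := continuous_triangle; fun_prop) _ _)
    (Continuous.intervalIntegrable (by have := continuous_triangle; fun_prop) _ _), hr, hl,
    sinc_of_ne_zero (by simpa using hs)]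
  have hcos : Complex.exp z + Complex.exp (-z) = 2 * Complex.cos s := by
    rw [Complex.cos, hz]; ring_nf
  have hcos2 : Complex.cos s = 1 - 2 * Complex.sin (s / 2) ^ 2 := by
    have h1 : (s : ℂ) = 2 * (s / 2) := by ring
    have h2 := Complex.sin_sq_add_cos_sq (s / 2 : ℂ)
    nth_rw 1 [h1]
    rw [Complex.cos_two_mul]
    linear_combination 2 * h2
  have hz2 : z ^ 2 = -(s : ℂ) ^ 2 := by rw [hz, mul_pow, Complex.I_sq]; ring
  have hs' : (s : ℂ) ≠ 0 := by exact_mod_cast hs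
  calc _ = (Complex.exp z + Complex.exp (-z) - 2) / z ^ 2 := by ring
    _ = _ := by
      rw [hcos, hcos2, hz2]
      push_cast
      field_simp
      ring

/-- The triangle function has Fourier transform sinc²(π w); inversion at 0 gives ∫ sinc²(π w) dw =
1. -/
lemma integral_sinc_sq : ∫ x, sinc x ^ 2 = π := by
  have hF : ∀ w : ℝ, w ≠ 0 → FourierTransform.fourier triangle w = ((sinc (w * π) ^ 2 : ℝ) : ℂ) := by
    intro w hw
    have h1 := integral_exp_mul_triangle (s := -2 * π * w) (by simp [hw, pi_ne_zero])
    rw [Real.fourier_real_eq_integral_exp_smul]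
    rw [show -2 * π * w / 2 = -(w * π) by ring, sinc_neg] at h1
    rw [← h1]
    refine integral_congr_ae (Eventually.of_forall fun x => ?_)
    simp only [smul_eq_mul]
    ring_nf
  have hae : FourierTransform.fourier triangle =ᵐ[volume]
      fun w : ℝ => ((sinc (w * π) ^ 2 : ℝ) : ℂ) := by
    have h0 : ∀ᵐ w : ℝ, w ≠ 0 := by simp [ae_iff, measure_singleton]
    filter_upwards [h0] with w hw using hF w hw
  have hi : Integrable (fun w : ℝ => sinc (w * π) ^ 2) :=
    integrable_sinc_sq.comp_mul_right' pi_ne_zero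
  have hinv := integrable_triangle.fourierInv_fourier_eq (hi.ofReal.congr hae.symm)
    (continuous_triangle.continuousAt (x := 0))
  rw [Real.fourierInv_eq'] at hinv
  simp only [inner_zero_right, mul_zero, Complex.ofReal_zero, zero_mul, Complex.exp_zero,
    one_smul] at hinv
  rw [integral_congr_ae hae, integral_complex_ofReal] at hinv
  have h1 : ∫ w : ℝ, sinc (w * π) ^ 2 = 1 := by
    have : triangle 0 = ((1 : ℝ) : ℂ) := by simp [triangle]
    rw [this] at hinv
    exact_mod_cast hinv
  rw [Measure.integral_comp_mul_right (fun x => sinc x ^ 2), abs_of_pos (by positivity),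
    smul_eq_mul, inv_mul_eq_div, div_eq_one_iff_eq pi_ne_zero] at h1
  exact h1

end SquareIntegral

/-! ### Gaussian majorant of sinc on [0, π] -/

section GaussianBound

/-- Euler's product, 1 - s ≤ exp(-s) and ζ(2) = π²/6 give sinc x ≤ exp(-x²/6), and π ≥ 3 weakens
this to the stated bound. For x ≤ π all factors are nonnegative. -/
lemma sinc_le_exp {x : ℝ} (h0 : 0 ≤ x) (h1 : x ≤ π) : sinc x ≤ exp (-(x ^ 2 / (2 * π))) := by
  rcases h0.eq_or_lt with rfl | hx
  · simp
  set t := x / π with ht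
  have hxt : x = π * t := by rw [ht]; field_simp
  have ht0 : 0 < t := div_pos hx pi_pos
  have ht1 : t ≤ 1 := div_le_one_of_le₀ h1 pi_pos.le
  have hprod := tendsto_euler_sin_prod t
  rw [← hxt] at hprod
  have hsum : Tendsto (fun n : ℕ => x * exp (-t ^ 2 * ∑ j ∈ Finset.range n, 1 / ((j : ℝ) + 1) ^ 2))
      atTop (𝓝 (x * exp (-t ^ 2 * (π ^ 2 / 6)))) := by
    have hz := (hasSum_nat_add_iff' (f := fun n : ℕ => (1 : ℝ) / (n : ℝ) ^ 2) 1).2 hasSum_zeta_two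
    have := hz.tendsto_sum_nat
    simp only [Finset.range_one, Finset.sum_singleton, Nat.cast_zero, Nat.cast_add, Nat.cast_one,
      ne_eq, OfNat.ofNat_ne_zero, not_false_eq_true, zero_pow, div_zero, sub_zero] at this
    exact ((this.const_mul _).rexp).const_mul x
  have hle : sin x ≤ x * exp (-t ^ 2 * (π ^ 2 / 6)) := by
    refine le_of_tendsto_of_tendsto' hprod hsum fun n => ?_
    refine mul_le_mul_of_nonneg_left ?_ hx.le
    rw [Finset.mul_sum, exp_sum]
    refine Finset.prod_le_prod (fun j _ => ?_) fun j _ => ?_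
    · rw [sub_nonneg, div_le_one (by positivity)]
      have : (0 : ℝ) ≤ j := j.cast_nonneg
      exact pow_le_pow_left₀ ht0.le (by linarith) 2
    · have := add_one_le_exp (-t ^ 2 * (1 / ((j : ℝ) + 1) ^ 2))
      refine le_trans (le_of_eq ?_) this
      ring
  rw [sinc_of_ne_zero hx.ne', div_le_iff₀ hx, mul_comm]
  refine hle.trans (mul_le_mul_of_nonneg_left (exp_le_exp.2 ?_) hx.le)
  have h2 : x ^ 2 / (2 * π) = t ^ 2 * (π / 2) := by rw [hxt]; field_simp
  rw [h2]
  have h3 : π / 2 ≤ π ^ 2 / 6 := by nlinarith [pi_gt_three]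
  nlinarith [mul_le_mul_of_nonneg_left h3 (sq_nonneg t)]

end GaussianBound

/-! ### Slope of |sinc| and lengths of level slabs -/

section Lipschitz

lemma hasDerivAt_sinc {x : ℝ} (hx : x ≠ 0) :
    HasDerivAt sinc ((x * cos x - sin x) / x ^ 2) x := by
  have h := (hasDerivAt_sin x).div (hasDerivAt_id x) hx
  have hev : sinc =ᶠ[𝓝 x] fun y => sin y / id y := by
    filter_upwards [isOpen_ne.mem_nhds hx] with y hy using sinc_of_ne_zero hy
  refine (h.congr_of_eventuallyEq hev).congr_deriv ?_
  simp [mul_comm]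

/-- The derivative of x cos x - sin x is -x sin x, of size at most x. The bound amounts to |sinc'| ≤
1/2. -/
lemma abs_mul_cos_sub_sin_le {x : ℝ} (hx : 0 ≤ x) : |x * cos x - sin x| ≤ x ^ 2 / 2 := by
  have key : ∀ ε : ℝ, |ε| ≤ 1 → 0 ≤ x ^ 2 / 2 + ε * (x * cos x - sin x) := by
    intro ε hε
    have hd : ∀ y : ℝ, HasDerivAt (fun y => y ^ 2 / 2 + ε * (y * cos y - sin y))
        (y - ε * y * sin y) y := fun y => by
      have h1 := (((hasDerivAt_id y).pow 2).div_const 2).add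
        ((((hasDerivAt_id y).mul (hasDerivAt_cos y)).sub (hasDerivAt_sin y)).const_mul ε)
      refine h1.congr_deriv ?_
      simp
      ring
    have hm : MonotoneOn (fun y => y ^ 2 / 2 + ε * (y * cos y - sin y)) (Ici 0) := by
      refine monotoneOn_of_deriv_nonneg (convex_Ici 0) (by fun_prop) (by fun_prop) fun y hy => ?_
      rw [interior_Ici] at hy
      rw [(hd y).deriv]
      have : |ε * sin y| ≤ 1 := by
        rw [abs_mul]; exact mul_le_one₀ hε (abs_nonneg _) (abs_sin_le_one y)
      nlinarith [(abs_le.1 this).2, mem_Ioi.1 hy]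
    simpa using hm (mem_Ici.2 le_rfl) (mem_Ici.2 hx) hx
  have h1 := key 1 (by simp)
  have h2 := key (-1) (by simp)
  rw [abs_le]
  constructor <;> linarith

lemma abs_mul_cos_sub_sin_le' {x : ℝ} (hx : π ≤ x) : |x * cos x - sin x| ≤ 1.05 * x := by
  have hp := pi_gt_d2
  refine abs_le_of_sq_le_sq ?_ (by linarith)
  have h1 := sin_sq_add_cos_sq x
  -- Cauchy-Schwarz; then √(1 + 1/π²) < 1.05 gives the constant.
  have h2 : (x * cos x - sin x) ^ 2 ≤ x ^ 2 + 1 := by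
    nlinarith [sq_nonneg (cos x + x * sin x)]
  nlinarith

lemma lipschitzOnWith_abs_sinc {a L : ℝ} (ha : 0 ≤ a) (hL : 0 ≤ L)
    (h : ∀ x, a < x → |x * cos x - sin x| ≤ L * x ^ 2) :
    LipschitzOnWith L.toNNReal (fun x => |sinc x|) (Ioi a) := by
  have h1 : LipschitzOnWith L.toNNReal sinc (Ioi a) := by
    refine (convex_Ioi a).lipschitzOnWith_of_nnnorm_hasDerivWithin_le
      (fun x hx => (hasDerivAt_sinc (ne_of_gt (lt_of_le_of_lt ha hx))).hasDerivWithinAt)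
      fun x hx => ?_
    rw [← NNReal.coe_le_coe, coe_nnnorm, coe_toNNReal _ hL, norm_eq_abs, abs_div,
      abs_of_nonneg (sq_nonneg x), div_le_iff₀ (pow_pos (lt_of_le_of_lt ha hx) 2)]
    exact h x hx
  refine LipschitzOnWith.of_dist_le_mul fun x hx y hy => ?_
  refine le_trans ?_ (h1.dist_le_mul x hx y hy)
  rw [dist_eq, dist_eq]
  exact abs_abs_sub_abs_le _ _

/-- By the intermediate value theorem φ attains every level in (y, y'), and an L-Lipschitz map
stretches length by at most the factor L. This does the work of a derivative bound for the
distribution function. -/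
lemma le_volume_of_lipschitzOnWith {φ : ℝ → ℝ} {a b y y' : ℝ} {L : ℝ}
    (hφ : Continuous φ) (hab : a ≤ b) (hlip : LipschitzOnWith L.toNNReal φ (Ioo a b))
    (h : (φ a ≤ y ∧ y' ≤ φ b) ∨ (φ b ≤ y ∧ y' ≤ φ a)) :
    ENNReal.ofReal (y' - y) ≤
      ENNReal.ofReal L * volume (Ioo a b ∩ φ ⁻¹' Ioo y y') := by
  have hsub : Ioo y y' ⊆ φ '' (Ioo a b ∩ φ ⁻¹' Ioo y y') := by
    intro t ht
    have : t ∈ φ '' Ioo a b := by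
      rcases h with ⟨h1, h2⟩ | ⟨h1, h2⟩
      · exact intermediate_value_Ioo hab hφ.continuousOn ⟨h1.trans_lt ht.1, ht.2.trans_le h2⟩
      · exact intermediate_value_Ioo' hab hφ.continuousOn ⟨h1.trans_lt ht.1, ht.2.trans_le h2⟩
    obtain ⟨x, hx, rfl⟩ := this
    exact ⟨x, ⟨hx, ht⟩, rfl⟩
  have h1 := (hlip.mono (inter_subset_left (t := φ ⁻¹' Ioo y y'))).hausdorffMeasure_image_le
    zero_le_one
  rw [hausdorffMeasure_real, ENNReal.rpow_one] at h1
  calc ENNReal.ofReal (y' - y) = volume (Ioo y y') := by rw [Real.volume_Ioo]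
    _ ≤ _ := measure_mono hsub
    _ ≤ _ := h1

end Lipschitz

end BallIntegral

namespace BallIntegral

open Set Filter Topology Real

/-! ### Rates of decrease of the two distribution functions -/

section Distribution

/-- The distribution function of `|sinc|` on the positive half-line. -/
noncomputable def sincDist (y : ℝ) : ENNReal := volume.restrict (Ioi 0) {x : ℝ | y < |sinc x|}

/-- The distribution function of `exp (-x² / (2π))` on the positive half-line. -/
noncomputable def gaussDist (y : ℝ) : ENNReal :=
  volume.restrict (Ioi 0) {x : ℝ | y < exp (-(x ^ 2 / (2 * π)))}

lemma sincDist_eq (y : ℝ) : sincDist y = volume {x : ℝ | 0 < x ∧ y < |sinc x|} := by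
  rw [sincDist, Measure.restrict_apply (measurableSet_lt measurable_const (by fun_prop))]
  congr 1
  ext x
  simp [and_comm]

lemma gaussDist_eq {y : ℝ} (h0 : 0 < y) (h1 : y ≤ 1) :
    gaussDist y = ENNReal.ofReal (√(2 * π * -log y)) := by
  have hl : 0 ≤ -log y := neg_nonneg.2 (log_nonpos h0.le h1)
  rw [gaussDist, Measure.restrict_apply (measurableSet_lt measurable_const (by fun_prop)),
    ← sub_zero (√(2 * π * -log y)), ← Real.volume_Ioo]
  congr 1
  ext x
  have hpi := pi_pos
  simp only [mem_inter_iff, mem_ofPred_eq, mem_Ioi, mem_Ioo]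
  rw [and_comm, and_congr_right_iff]
  intro hx
  rw [← log_lt_iff_lt_exp h0, lt_sqrt hx.le, lt_neg, div_lt_iff₀ (by positivity), mul_comm]

lemma abs_sinc_le_inv {x : ℝ} (hx : 0 < x) : |sinc x| ≤ 1 / x := by
  rw [sinc_of_ne_zero hx.ne', abs_div, abs_of_pos hx]
  gcongr
  exact abs_sin_le_one x

lemma sincDist_ne_top {y : ℝ} (hy : 0 < y) : sincDist y ≠ ⊤ := by
  have hsub : {x : ℝ | 0 < x ∧ y < |sinc x|} ⊆ Ioo 0 (1 / y) := fun x hx =>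
    ⟨hx.1, by
      have := hx.2.trans_le (abs_sinc_le_inv hx.1)
      rw [lt_div_iff₀ hx.1] at this
      rw [lt_div_iff₀ hy]; linarith⟩
  rw [sincDist_eq]
  exact ((measure_mono hsub).trans_lt (by simp)).ne

lemma abs_sinc_nat_mul_pi {j : ℕ} (hj : 1 ≤ j) : |sinc (j * π)| = 0 := by
  have : (j : ℝ) * π ≠ 0 := by positivity
  rw [sinc_of_ne_zero this, sin_nat_mul_pi, zero_div, abs_zero]

/-- The part of the level slab `{y < |sinc| < y'}` in the `j`-th nodal interval. -/
def slab (y y' : ℝ) (j : ℕ) : Set ℝ :=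
  Ioo (j * π) ((j + 1 : ℕ) * π) ∩ (fun x => |sinc x|) ⁻¹' Ioo y y'

lemma measurableSet_slab (y y' : ℝ) (j : ℕ) : MeasurableSet (slab y y' j) :=
  measurableSet_Ioo.inter (measurable_sinc.abs measurableSet_Ioo)

lemma le_volume_slab_zero {y y' : ℝ} (hy : 0 ≤ y) (hy' : y' ≤ 1) :
    ENNReal.ofReal (2 * (y' - y)) ≤ volume (slab y y' 0) := by
  have hlip := lipschitzOnWith_abs_sinc (a := 0) (L := 1 / 2) le_rfl (by norm_num) fun x hx => by
    have := abs_mul_cos_sub_sin_le (le_of_lt hx); linarith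
  have h := le_volume_of_lipschitzOnWith (φ := fun x => |sinc x|) (a := 0) (b := π) (y := y)
    (y' := y') (by fun_prop) pi_pos.le (hlip.mono Ioo_subset_Ioi_self)
    (Or.inr ⟨by simpa [sinc_of_ne_zero pi_ne_zero] using hy, by simpa using hy'⟩)
  have hs : slab y y' 0 = Ioo 0 π ∩ (fun x => |sinc x|) ⁻¹' Ioo y y' := by
    ext x; simp [slab]
  rw [hs, ENNReal.ofReal_mul (by norm_num)]
  calc _ ≤ ENNReal.ofReal 2 * (ENNReal.ofReal (1 / 2) * _) := by gcongr
    _ = _ := by rw [← mul_assoc, ← ENNReal.ofReal_mul (by norm_num)]; norm_num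

/-- On the j-th hump |sinc| rises from 0 to at least y' at ξ and returns to 0, with slope at most
1.05 / (jπ); the factor 2 counts the two passages. -/
lemma le_volume_slab {y y' ξ : ℝ} {j : ℕ} (hj : 1 ≤ j) (hy : 0 ≤ y)
    (hξ : ξ ∈ Icc (j * π) ((j + 1 : ℕ) * π)) (hy' : y' ≤ |sinc ξ|) :
    ENNReal.ofReal (2 * (j * π / 1.05) * (y' - y)) ≤ volume (slab y y' j) := by
  have hjp : π ≤ j * π := by
    have : (1 : ℝ) ≤ j := by exact_mod_cast hj
    nlinarith [pi_pos]
  have hjp0 : 0 < j * π := pi_pos.trans_le hjp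
  have hlip := lipschitzOnWith_abs_sinc (a := j * π) (L := 1.05 / (j * π)) hjp0.le
    (by positivity) fun x hx => by
    refine (abs_mul_cos_sub_sin_le' (hjp.trans hx.le)).trans ?_
    rw [div_mul_eq_mul_div, le_div_iff₀ hjp0]
    nlinarith
  have h1 := le_volume_of_lipschitzOnWith (φ := fun x => |sinc x|) (a := j * π) (b := ξ) (y := y)
    (y' := y') (by fun_prop) hξ.1 (hlip.mono Ioo_subset_Ioi_self)
    (Or.inl ⟨by simpa [abs_sinc_nat_mul_pi hj] using hy, hy'⟩)
  have h2 := le_volume_of_lipschitzOnWith (φ := fun x => |sinc x|) (a := ξ)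
    (b := (j + 1 : ℕ) * π) (y := y)
    (y' := y') (by fun_prop) hξ.2 (hlip.mono (Ioo_subset_Ioi_self.trans (Ioi_subset_Ioi hξ.1)))
    (Or.inr ⟨by simpa only [abs_sinc_nat_mul_pi (j := j + 1) (by omega)] using hy, hy'⟩)
  have hdisj : Disjoint (Ioo (j * π) ξ ∩ (fun x => |sinc x|) ⁻¹' Ioo y y')
      (Ioo ξ ((j + 1 : ℕ) * π) ∩ (fun x => |sinc x|) ⁻¹' Ioo y y') := by
    rw [Set.disjoint_left]
    exact fun x hx hx' => lt_asymm hx.1.2 hx'.1.1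
  have hsub : (Ioo (j * π) ξ ∩ (fun x => |sinc x|) ⁻¹' Ioo y y') ∪
      (Ioo ξ ((j + 1 : ℕ) * π) ∩ (fun x => |sinc x|) ⁻¹' Ioo y y') ⊆ slab y y' j := by
    rintro x (hx | hx)
    · exact ⟨⟨hx.1.1, hx.1.2.trans_le hξ.2⟩, hx.2⟩
    · exact ⟨⟨hξ.1.trans_lt hx.1.1, hx.1.2⟩, hx.2⟩
  refine le_trans ?_ (measure_mono hsub)
  rw [measure_union hdisj (measurableSet_Ioo.inter
    ((measurable_sinc.abs) measurableSet_Ioo))]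
  set A := volume (Ioo (j * π) ξ ∩ (fun x => |sinc x|) ⁻¹' Ioo y y')
  set B := volume (Ioo ξ ((j + 1 : ℕ) * π) ∩ (fun x => |sinc x|) ⁻¹' Ioo y y')
  have hc : ∀ C : ENNReal, ENNReal.ofReal (j * π / 1.05) * (ENNReal.ofReal (1.05 / (j * π)) * C)
      = C := fun C => by
    rw [← mul_assoc, ← ENNReal.ofReal_mul (by positivity)]
    rw [div_mul_div_cancel₀ (by norm_num), div_self hjp0.ne', ENNReal.ofReal_one, one_mul]
  calc ENNReal.ofReal (2 * (j * π / 1.05) * (y' - y))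
      = ENNReal.ofReal (j * π / 1.05) * ENNReal.ofReal (y' - y) +
        ENNReal.ofReal (j * π / 1.05) * ENNReal.ofReal (y' - y) := by
        rw [← two_mul, ← ENNReal.ofReal_mul (by positivity), mul_assoc,
          ENNReal.ofReal_mul (p := 2) (by norm_num)]
        simp
    _ ≤ ENNReal.ofReal (j * π / 1.05) * (ENNReal.ofReal (1.05 / (j * π)) * A) +
        ENNReal.ofReal (j * π / 1.05) * (ENNReal.ofReal (1.05 / (j * π)) * B) := by gcongr
    _ = A + B := by rw [hc, hc]

/-- The initial hump contributes 2, and humps 1, …, m, which all reach level y', contribute ∑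
2jπ/1.05 = π m (m + 1)/1.05. -/
lemma sincDist_add_le {y y' : ℝ} (m : ℕ) (hy : 0 ≤ y) (hyy : y ≤ y') (hy' : y' ≤ 1)
    (hξ : ∀ j : ℕ, 1 ≤ j → j ≤ m → ∃ ξ ∈ Icc (j * π) ((j + 1 : ℕ) * π), y' ≤ |sinc ξ|) :
    sincDist y' + ENNReal.ofReal ((2 + π * m * (m + 1) / 1.05) * (y' - y)) ≤ sincDist y := by
  have hdisj : Pairwise (Function.onFun Disjoint (slab y y')) := by
    intro i j hij
    rw [Function.onFun, Set.disjoint_left]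
    have hp := pi_pos
    have key : ∀ i j : ℕ, i < j → ∀ x, x ∈ slab y y' i → x ∉ slab y y' j := by
      intro i j hij x hx hx'
      have h1 : ((i + 1 : ℕ) : ℝ) * π ≤ j * π := by
        gcongr; exact hij
      exact lt_asymm (hx.1.2.trans_le h1) hx'.1.1
    intro x hx hx'
    rcases lt_or_gt_of_ne hij with h | h
    · exact key i j h x hx hx'
    · exact key j i h x hx' hx
  have hsum : ∀ k : ℕ, k ≤ m → ENNReal.ofReal ((2 + π * k * (k + 1) / 1.05) * (y' - y)) ≤
      ∑ j ∈ Finset.range (k + 1), volume (slab y y' j) := by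
    intro k
    induction k with
    | zero =>
      intro _
      simpa using le_volume_slab_zero hy hy'
    | succ k ih =>
      intro hk
      obtain ⟨ξ, hξ1, hξ2⟩ := hξ (k + 1) (by omega) hk
      have h1 := le_volume_slab (j := k + 1) (by omega) hy hξ1 hξ2
      rw [Finset.sum_range_succ]
      refine le_trans ?_ (add_le_add (ih (by omega)) h1)
      have hp := pi_pos
      have := sub_nonneg.2 hyy
      rw [← ENNReal.ofReal_add (by positivity) (by positivity)]
      refine ENNReal.ofReal_le_ofReal (le_of_eq ?_)
      push_cast
      ring
  have hm := hsum m le_rfl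
  rw [← measure_biUnion_finset (fun i _ j _ hij => hdisj hij)
    fun j _ => measurableSet_slab y y' j] at hm
  refine (add_le_add le_rfl hm).trans ?_
  rw [sincDist_eq, sincDist_eq, ← measure_union]
  · refine measure_mono ?_
    rintro x (hx | hx)
    · exact ⟨hx.1, hyy.trans_lt hx.2⟩
    · simp only [mem_iUnion] at hx
      obtain ⟨j, _, hx⟩ := hx
      exact ⟨lt_of_le_of_lt (by have := pi_pos; positivity) hx.1.1, hx.2.1⟩
  · rw [Set.disjoint_left]
    intro x hx hx'
    simp only [mem_iUnion] at hx'
    obtain ⟨j, _, hx'⟩ := hx'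
    exact lt_asymm hx.2 hx'.2.2
  · exact Finset.measurableSet_biUnion _ fun j _ => measurableSet_slab y y' j

/-- This puts the steepest slope of the Gaussian distribution function √(-2π log t) at the left end
of an interval of levels. -/
lemma mul_sqrt_log_mono {z y : ℝ} (hz : 0 < z) (hzy : z ≤ y) (hy : y ≤ exp (-(1 / 2))) :
    z * √(-log z) ≤ y * √(-log y) := by
  have hy0 := hz.trans_le hzy
  have hly : 1 / 2 ≤ -log y := by
    have := log_le_log hy0 hy
    rw [log_exp] at this; linarith
  have hlz : -log y ≤ -log z := neg_le_neg (log_le_log hz hzy)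
  have h1 : z ^ 2 * -log z ≤ y ^ 2 * -log y := by
    have hz2 : z ^ 2 = exp (2 * log z) := by
      rw [mul_comm, exp_mul, exp_log hz]; norm_num
    have hy2 : y ^ 2 = exp (2 * log z) * exp (2 * (-log z - -log y)) := by
      rw [← exp_add, show 2 * log z + 2 * (-log z - -log y) = log y * 2 by ring, exp_mul,
        exp_log hy0]
      norm_num
    rw [hz2, hy2, mul_assoc]
    refine mul_le_mul_of_nonneg_left ?_ (exp_pos _).le
    have := add_one_le_exp (2 * (-log z - -log y))
    nlinarith
  have := sqrt_le_sqrt h1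
  rwa [sqrt_mul (sq_nonneg z), sqrt_mul (sq_nonneg y), sqrt_sq hz.le, sqrt_sq hy0.le] at this

lemma sqrt_log_sub_le {z y y' : ℝ} (hz : 0 < z) (hzy : z ≤ y) (hyy : y ≤ y')
    (hy' : y' ≤ exp (-(1 / 2))) :
    √(2 * π * -log y) - √(2 * π * -log y') ≤ √(π / 2) / (z * √(-log z)) * (y' - y) := by
  have he : exp (-(1 / 2)) < 1 := exp_lt_one_iff.2 (by norm_num)
  have hl : ∀ t, 0 < t → t ≤ exp (-(1 / 2)) → 0 < -log t := fun t h0 h1 =>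
    neg_pos.2 (log_neg h0 (h1.trans_lt he))
  have hd : ∀ t, 0 < t → t ≤ exp (-(1 / 2)) →
      HasDerivAt (fun t => -√(2 * π * -log t)) (√(π / 2) / (t * √(-log t))) t := by
    intro t h0 h1
    have hlt := hl t h0 h1
    have hpi := pi_pos
    have h2 := ((((hasDerivAt_log h0.ne').neg).const_mul (2 * π)).sqrt
      (by have : 0 < 2 * π * -log t := by positivity
          exact this.ne')).neg
    refine h2.congr_deriv ?_
    have e1 : √(2 * π * -log t) = √(2 * π) * √(-log t) := sqrt_mul (by positivity) _
    have e2 : 2 * π = √(2 * π) * √(2 * π) := (mul_self_sqrt (by positivity)).symm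
    have e3 : √(π / 2) = √(2 * π) / 2 := by
      rw [show π / 2 = (2 * π) / 2 ^ 2 by ring, sqrt_div (by positivity), sqrt_sq (by norm_num)]
    have h3 : 0 < √(-log t) := sqrt_pos.2 hlt
    have h4 : 0 < √(2 * π) := sqrt_pos.2 (by positivity)
    rw [Pi.neg_apply, e1, e3]
    field_simp
    rw [sq_sqrt (by positivity)]
  have hconv := (convex_Icc y y').image_sub_le_mul_sub_of_deriv_le
    (f := fun t => -√(2 * π * -log t)) (C := √(π / 2) / (z * √(-log z)))
    (fun t ht => (hd t (by linarith [ht.1]) (ht.2.trans hy')).continuousAt.continuousWithinAt)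
    (fun t ht => (hd t (by linarith [(interior_subset ht).1])
      ((interior_subset ht).2.trans hy')).differentiableAt.differentiableWithinAt)
    (fun t ht => by
      have ht' := interior_subset ht
      rw [(hd t (by linarith [ht'.1]) (ht'.2.trans hy')).deriv]
      have h5 : 0 < √(-log z) := sqrt_pos.2 (hl z hz (hzy.trans (hyy.trans hy')))
      gcongr √(π / 2) / ?_
      exact mul_sqrt_log_mono hz (hzy.trans ht'.1) (ht'.2.trans hy'))
    y (left_mem_Icc.2 hyy) y' (right_mem_Icc.2 hyy) hyy
  linarith

end Distribution

/-! ### Single crossing of the distribution functions -/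

section Crossing

/-- Since z ≤ 2/(5π) and 5π/2 > e², -log z ≥ 2. The Gaussian rate is then at most √π/2 · (m + 3/2)π,
linear in m, against a quadratic rate for |sinc|; the tightest case is m = 1. -/
lemma sqrt_div_mul_sqrt_log_le {m : ℕ} (hm : 1 ≤ m) {z : ℝ} (hz : z = 1 / ((m + 3 / 2) * π)) :
    √(π / 2) / (z * √(-log z)) ≤ 2 + π * m * (m + 1) / 1.05 := by
  have hm1 : (1 : ℝ) ≤ m := by exact_mod_cast hm
  have hp := pi_pos
  have hz0 : 0 < z := by rw [hz]; positivity
  have hlog : 2 ≤ -log z := by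
    rw [hz, one_div, log_inv, neg_neg, le_log_iff_exp_le (by positivity)]
    have h1 : exp 2 = exp 1 ^ 2 := by rw [← exp_nat_mul]; norm_num
    have h2 := exp_one_lt_d9
    have h3 := exp_pos 1
    have h4 := pi_gt_d2
    rw [h1]
    nlinarith
  have h2 : √2 ≤ √(-log z) := sqrt_le_sqrt hlog
  have h3 : √(π / 2) = √π / √2 := sqrt_div hp.le _
  have h4 : √π ≤ 1.7725 := by
    rw [sqrt_le_left (by norm_num)]
    have := pi_lt_d4; norm_num; linarith
  have h5 : (0 : ℝ) < √2 := by positivity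
  have h6 : √2 * √2 = 2 := mul_self_sqrt (by norm_num)
  calc √(π / 2) / (z * √(-log z)) ≤ √(π / 2) / (z * √2) := by gcongr
    _ = √π / 2 * ((m + 3 / 2) * π) := by
        have h7 : √π / √2 / (z * √2) = √π * ((m + 3 / 2) * π) / (√2 * √2) := by
          rw [hz]; field_simp
        rw [h3, h7, h6]; ring
    _ ≤ 1.7725 / 2 * ((m + 3 / 2) * π) := by gcongr
    _ ≤ _ := by
        have h7 := pi_lt_d4
        have h8 := pi_gt_d2
        have h9 : (m : ℝ) ≤ m * m := by nlinarith
        rw [show π * m * (m + 1) / 1.05 = π * ((m * m + m) / 1.05) by ring]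
        have h10 : (m * m + m) / 1.05 - 1.7725 / 2 * (m + 3 / 2) ≥ -(0.32 : ℝ) := by
          have : (m * m + m) / 1.05 = (m * m + m : ℝ) * (20 / 21) := by norm_num; ring
          rw [this]; nlinarith
        nlinarith

/-- The difference of the two distribution functions. -/
noncomputable def distDiff (y : ℝ) : ℝ := (sincDist y).toReal - √(2 * π * -log y)

lemma distDiff_le {m : ℕ} (hm : 1 ≤ m) {y y' : ℝ} (hz : 1 / ((m + 3 / 2) * π) ≤ y)
    (hyy : y ≤ y') (hy' : y' ≤ 1 / π)
    (hξ : ∀ j : ℕ, 1 ≤ j → j ≤ m → ∃ ξ ∈ Icc (j * π) ((j + 1 : ℕ) * π), y' ≤ |sinc ξ|) :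
    distDiff y' ≤ distDiff y := by
  have hp := pi_pos
  have hz0 : 0 < 1 / ((m + 3 / 2) * π) := by positivity
  have hy0 : 0 < y := hz0.trans_le hz
  have hpe : 1 / π ≤ exp (-(1 / 2)) := by
    rw [exp_neg, ← one_div]
    refine one_div_le_one_div_of_le (exp_pos _) ?_
    have h1 : exp (1 / 2) ≤ exp 1 := exp_le_exp.2 (by norm_num)
    have h2 := exp_one_lt_d9
    have h3 := pi_gt_d2
    linarith
  have hp1 : 1 / π ≤ 1 := by
    rw [div_le_one hp]; linarith [pi_gt_three]
  have h1 := sincDist_add_le m hy0.le hyy (hy'.trans hp1) hξ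
  have h2 := sqrt_log_sub_le hz0 hz hyy (hy'.trans hpe)
  have h3 := mul_le_mul_of_nonneg_right (sqrt_div_mul_sqrt_log_le hm rfl) (sub_nonneg.2 hyy)
  have h4 := ENNReal.toReal_mono (sincDist_ne_top hy0) h1
  rw [ENNReal.toReal_add (sincDist_ne_top (hy0.trans_le hyy)) ENNReal.ofReal_ne_top,
    ENNReal.toReal_ofReal (mul_nonneg (by positivity) (sub_nonneg.2 hyy))] at h4
  unfold distDiff
  linarith

lemma abs_sinc_half {j : ℕ} : |sinc ((j + 1 / 2) * π)| = 1 / ((j + 1 / 2) * π) := by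
  have h0 : 0 < (j + 1 / 2) * π := by positivity
  rw [sinc_of_ne_zero h0.ne', abs_div, abs_of_pos h0]
  congr 1
  have h1 : cos ((j + 1 / 2) * π) = 0 := by
    rw [cos_eq_zero_iff]; exact ⟨j, by push_cast; ring⟩
  have h2 := sin_sq_add_cos_sq ((j + 1 / 2) * π)
  rw [h1] at h2
  rw [← sq_eq_sq₀ (abs_nonneg _) zero_le_one, sq_abs]
  linarith

/-- `distDiff` is antitone up to the height `y₁` of the second hump of `|sinc|`, beyond which
`|sinc|` only exceeds the level on the first hump. -/
lemma exists_antitone_distDiff :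
    ∃ y₁ : ℝ, 0 < y₁ ∧ y₁ < 1 ∧ AntitoneOn distDiff (Ioc 0 y₁) ∧
      ∀ x, π < x → |sinc x| ≤ y₁ := by
  have hp := pi_pos
  obtain ⟨ξ, hξ, hmax⟩ := (isCompact_Icc (a := π) (b := 2 * π)).exists_isMaxOn
    (nonempty_Icc.2 (by linarith)) continuous_sinc.abs.continuousOn
  have hhalf : 1 / ((1 + 1 / 2) * π) ≤ |sinc ξ| := by
    have := hmax (show (1 + 1 / 2) * π ∈ Icc π (2 * π) by constructor <;> linarith)
    have h2 := abs_sinc_half (j := 1)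
    rw [Nat.cast_one] at h2
    rw [← h2]; exact this
  have hle : |sinc ξ| ≤ 1 / π := (abs_sinc_le_inv (hp.trans_le hξ.1)).trans
    (one_div_le_one_div_of_le hp hξ.1)
  have hξ' : ξ ∈ Icc (((1 : ℕ) : ℝ) * π) ((1 + 1 : ℕ) * π) := by
    constructor
    · simpa using hξ.1
    · push_cast; linarith [hξ.2]
  refine ⟨|sinc ξ|, lt_of_lt_of_le (by positivity) hhalf, hle.trans_lt ?_, ?_, ?_⟩
  · rw [div_lt_one hp]; linarith [pi_gt_three]
  -- Down to level 1/((m + 3/2)π) at least m humps are available. The first range uses the maximiser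
  -- ξ itself; each later one uses the points (j + 1/2)π with j ≤ m + 1, and the ranges are glued at
  -- common endpoints.
  · have hind : ∀ m : ℕ, 1 ≤ m → AntitoneOn distDiff (Icc (1 / ((m + 3 / 2) * π)) |sinc ξ|) := by
      intro m hm
      induction m, hm using Nat.le_induction with
      | base =>
        intro y hy y' hy' hyy
        refine distDiff_le le_rfl hy.1 hyy (hy'.2.trans hle) fun j h1 h2 => ?_
        obtain rfl : j = 1 := le_antisymm h2 h1
        exact ⟨ξ, hξ', hy'.2⟩
      | succ m hm ih =>
        have hstep : AntitoneOn distDiff (Icc (1 / (((m + 1 : ℕ) + 3 / 2) * π))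
            (1 / ((m + 3 / 2) * π))) := by
          intro y hy y' hy' hyy
          refine distDiff_le (m := m + 1) (by omega) hy.1 hyy (hy'.2.trans ?_) fun j h1 h2 => ?_
          · refine one_div_le_one_div_of_le hp ?_
            have : (0 : ℝ) ≤ m := m.cast_nonneg
            nlinarith
          · refine ⟨(j + 1 / 2) * π, ⟨by nlinarith, by push_cast; nlinarith⟩, ?_⟩
            rw [abs_sinc_half]
            refine hy'.2.trans (one_div_le_one_div_of_le (by positivity) ?_)
            have : (j : ℝ) ≤ m + 1 := by exact_mod_cast h2
            gcongr ?_ * π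
            linarith
        have hc1 : 1 / (((m + 1 : ℕ) + 3 / 2) * π) ≤ 1 / ((m + 3 / 2) * π) := by
          refine one_div_le_one_div_of_le (by positivity) ?_
          push_cast
          gcongr ?_ * π
          linarith
        have hc2 : 1 / ((m + 3 / 2) * π) ≤ |sinc ξ| := by
          refine le_trans (one_div_le_one_div_of_le (by positivity) ?_) hhalf
          have : (0 : ℝ) ≤ m := m.cast_nonneg
          gcongr ?_ * π
          linarith
        have := hstep.union_right ih (isGreatest_Icc hc1) (isLeast_Icc hc2)
        rwa [Icc_union_Icc_eq_Icc hc1 hc2] at this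
    intro y hy y' hy' hyy
    obtain ⟨m, hm⟩ := exists_nat_gt (1 / (y * π))
    have hmy : 1 / (((m + 1 : ℕ) + 3 / 2) * π) ≤ y := by
      rw [div_lt_iff₀ (mul_pos hy.1 hp)] at hm
      rw [div_le_iff₀ (by positivity)]
      push_cast
      nlinarith [mul_pos hy.1 hp]
    exact hind (m + 1) (by omega) ⟨hmy, hy.2⟩ ⟨hmy.trans hyy, hy'.2⟩ hyy
  · intro x hx
    rcases le_or_gt x (2 * π) with h | h
    · exact hmax ⟨hx.le, h⟩
    · refine (abs_sinc_le_inv (hp.trans hx)).trans (le_trans ?_ hhalf)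
      exact one_div_le_one_div_of_le (by positivity) (by linarith)

lemma sincDist_le_gaussDist_iff {y : ℝ} (h0 : 0 < y) (h1 : y ≤ 1) :
    sincDist y ≤ gaussDist y ↔ distDiff y ≤ 0 := by
  rw [gaussDist_eq h0 h1, distDiff, sub_nonpos, ENNReal.le_ofReal_iff_toReal_le (sincDist_ne_top h0)
    (sqrt_nonneg _)]

lemma gaussDist_le_sincDist_iff {y : ℝ} (h0 : 0 < y) (h1 : y ≤ 1) :
    gaussDist y ≤ sincDist y ↔ 0 ≤ distDiff y := by
  rw [gaussDist_eq h0 h1, distDiff, sub_nonneg, ENNReal.ofReal_le_iff_le_toReal (sincDist_ne_top h0)]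

/-- The two distribution functions cross exactly once. -/
lemma exists_crossing : ∃ y₀ : ℝ, 0 ≤ y₀ ∧ (∀ t, 0 < t → t < y₀ → gaussDist t ≤ sincDist t) ∧
    ∀ t, 0 < t → y₀ < t → sincDist t ≤ gaussDist t := by
  obtain ⟨y₁, hy0, hy1, hanti, htail⟩ := exists_antitone_distDiff
  -- At these levels the superlevel set of |sinc| lies in (0, π], where the Gaussian dominates
  -- pointwise.
  have hbig : ∀ t, y₁ ≤ t → sincDist t ≤ gaussDist t := by
    intro t ht
    rw [sincDist_eq, gaussDist, Measure.restrict_apply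
      (measurableSet_lt measurable_const (by fun_prop))]
    refine measure_mono fun x hx => ⟨?_, hx.1⟩
    have hxp : x ≤ π := by
      by_contra! h
      exact (hx.2.trans_le (htail x h)).not_ge ht
    have hs : 0 ≤ sinc x := by
      rw [sinc_of_ne_zero hx.1.ne']
      exact div_nonneg (sin_nonneg_of_nonneg_of_le_pi hx.1.le hxp) hx.1.le
    have h2 := hx.2
    rw [abs_of_nonneg hs] at h2
    exact h2.trans_le (sinc_le_exp hx.1.le hxp)
  -- The crossing level is the supremum of S, or 0 if S is empty.
  set S : Set ℝ := {y | 0 < y ∧ y ≤ y₁ ∧ 0 ≤ distDiff y} with hS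
  have hSb : BddAbove S := ⟨y₁, fun y hy => hy.2.1⟩
  rcases S.eq_empty_or_nonempty with hE | hne
  · refine ⟨0, le_rfl, fun t h0 h1 => absurd h1 h0.not_gt, fun t h0 _ => ?_⟩
    rcases le_total y₁ t with h | h
    · exact hbig t h
    · rw [sincDist_le_gaussDist_iff h0 (h.trans hy1.le)]
      by_contra! hc
      have : t ∈ S := ⟨h0, h, hc.le⟩
      rw [hE] at this
      exact this
  · refine ⟨sSup S, ?_, fun t h0 h1 => ?_, fun t h0 h1 => ?_⟩
    · obtain ⟨y, hy⟩ := hne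
      exact hy.1.le.trans (le_csSup hSb hy)
    · obtain ⟨y, hy, hty⟩ := exists_lt_of_lt_csSup hne h1
      have ht1 : t ≤ y₁ := hty.le.trans hy.2.1
      rw [gaussDist_le_sincDist_iff h0 (ht1.trans hy1.le)]
      exact hy.2.2.trans (hanti ⟨h0, ht1⟩ ⟨hy.1, hy.2.1⟩ hty.le)
    · rcases le_total y₁ t with h | h
      · exact hbig t h
      · rw [sincDist_le_gaussDist_iff h0 (h.trans hy1.le)]
        by_contra! hc
        exact h1.not_ge (le_csSup hSb ⟨h0, h, hc.le⟩)

end Crossing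

/-! ### Ball's integral inequality -/

section Main

/-- If two distribution functions cross once, an inequality between the first weighted moments
propagates to all higher ones. -/
lemma lintegral_rpow_le_of_crossing {F G : ℝ → ENNReal} (hF : Measurable F) (hG : Measurable G)
    {y₀ p : ℝ} (hy : 0 ≤ y₀) (hp : 2 ≤ p) (h1 : ∀ t, 0 < t → t < y₀ → G t ≤ F t)
    (h2 : ∀ t, 0 < t → y₀ < t → F t ≤ G t)
    (hle : ∫⁻ t in Ioi 0, F t * ENNReal.ofReal t ≤ ∫⁻ t in Ioi 0, G t * ENNReal.ofReal t)
    (hfin : ∫⁻ t in Ioi 0, G t * ENNReal.ofReal t ≠ ⊤) :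
    ∫⁻ t in Ioi 0, F t * ENNReal.ofReal (t ^ (p - 1)) ≤
      ∫⁻ t in Ioi 0, G t * ENNReal.ofReal (t ^ (p - 1)) := by
  set c := ENNReal.ofReal (y₀ ^ (p - 2)) with hc
  have hmul : ∀ t : ℝ, 0 < t → t ^ (p - 1) = t ^ (p - 2) * t := fun t ht => by
    rw [← rpow_add_one ht.ne']; congr 1; ring
  -- This is (A - B)(b - a) ≥ 0 without subtraction. It is used for (F - G)(t^(p-2) - y₀^(p-2)) ≤ 0,
  -- whose two factors have opposite signs on each side of y₀.
  have key : ∀ {A B a b : ENNReal}, B ≤ A → a ≤ b → A * a + B * b ≤ B * a + A * b := by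
    intro A B a b hBA hab
    obtain ⟨e, rfl⟩ := exists_add_of_le hab
    rw [mul_add, mul_add, ← add_assoc, ← add_assoc, add_comm (A * a)]
    gcongr
  have hpt : ∫⁻ t in Ioi 0, (F t * ENNReal.ofReal (t ^ (p - 1)) + G t * (ENNReal.ofReal t * c)) ≤
      ∫⁻ t in Ioi 0, (G t * ENNReal.ofReal (t ^ (p - 1)) + F t * (ENNReal.ofReal t * c)) := by
    refine lintegral_mono_ae ?_
    have hne : ∀ᵐ t : ℝ, t ≠ y₀ := by simp [ae_iff, measure_singleton]
    filter_upwards [ae_restrict_mem measurableSet_Ioi, ae_restrict_of_ae hne] with t ht hty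
    have ht0 : 0 < t := ht
    rw [hc, ← ENNReal.ofReal_mul ht0.le, hmul t ht0, mul_comm t]
    rcases lt_or_gt_of_ne hty with h | h
    · refine key (h1 t ht0 h) (ENNReal.ofReal_le_ofReal ?_)
      gcongr
    · refine (add_comm _ _).trans_le ((key (h2 t ht0 h) (ENNReal.ofReal_le_ofReal ?_)).trans_eq
        (add_comm _ _))
      gcongr
  have hm1 : Measurable fun t : ℝ => F t * ENNReal.ofReal (t ^ (p - 1)) := by fun_prop
  have hm2 : Measurable fun t : ℝ => G t * ENNReal.ofReal (t ^ (p - 1)) := by fun_prop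
  rw [lintegral_add_left hm1, lintegral_add_left hm2] at hpt
  simp only [← mul_assoc] at hpt
  rw [lintegral_mul_const' _ _ ENNReal.ofReal_ne_top,
    lintegral_mul_const' _ _ ENNReal.ofReal_ne_top] at hpt
  have h3 : (∫⁻ t in Ioi 0, F t * ENNReal.ofReal (t ^ (p - 1))) +
      (∫⁻ t in Ioi 0, G t * ENNReal.ofReal t) * c ≤
      (∫⁻ t in Ioi 0, G t * ENNReal.ofReal (t ^ (p - 1))) +
      (∫⁻ t in Ioi 0, G t * ENNReal.ofReal t) * c := hpt.trans (by gcongr)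
  exact (ENNReal.add_le_add_iff_right (ENNReal.mul_ne_top hfin ENNReal.ofReal_ne_top)).1 h3

lemma antitone_sincDist : Antitone sincDist := fun _ _ h =>
  measure_mono fun _ hx => lt_of_le_of_lt h hx

lemma antitone_gaussDist : Antitone gaussDist := fun _ _ h =>
  measure_mono fun _ hx => lt_of_le_of_lt h hx

lemma lintegral_sinc_rpow {p : ℝ} (hp : 1 < p) :
    ENNReal.ofReal (∫ x, |sinc x| ^ p) =
      2 * ∫⁻ x in Ioi (0 : ℝ), ENNReal.ofReal (|sinc x| ^ p) := by
  have h1 := integral_comp_abs (f := fun x => |sinc x| ^ p)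
  have h2 : ∀ x : ℝ, |sinc (|x|)| = |sinc x| := fun x => by
    rcases abs_choice x with h | h
    · rw [h]
    · rw [h, sinc_neg]
  simp only [h2] at h1
  rw [h1, ENNReal.ofReal_mul (by norm_num), ofReal_integral_eq_lintegral_ofReal
    (integrable_abs_sinc_rpow hp).integrableOn (Eventually.of_forall fun x => by positivity)]
  simp

lemma lintegral_gauss_rpow {p : ℝ} (hp : 0 < p) :
    2 * ∫⁻ x in Ioi (0 : ℝ), ENNReal.ofReal (exp (-(x ^ 2 / (2 * π))) ^ p) =
      ENNReal.ofReal (π * √(2 / p)) := by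
  have hpi := pi_pos
  have he : ∀ x : ℝ, exp (-(x ^ 2 / (2 * π))) ^ p = exp (-(p / (2 * π)) * x ^ 2) := fun x => by
    rw [← exp_mul]; congr 1; ring
  simp only [he]
  rw [← ofReal_integral_eq_lintegral_ofReal
    (integrable_exp_neg_mul_sq (by positivity)).integrableOn
    (Eventually.of_forall fun x => (exp_pos _).le), integral_gaussian_Ioi,
    show (2 : ENNReal) = ENNReal.ofReal 2 by simp, ← ENNReal.ofReal_mul (by norm_num)]
  congr 1
  rw [mul_div_cancel₀ _ (by norm_num), show π / (p / (2 * π)) = π ^ 2 * (2 / p) by field_simp,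
    sqrt_mul (by positivity), sqrt_sq hpi.le]

/-- Ball's integral inequality. -/
theorem integral_abs_sinc_rpow_le {p : ℝ} (hp : 2 ≤ p) :
    ∫ x, |sinc x| ^ p ≤ π * √(2 / p) := by
  obtain ⟨y₀, hy, h1, h2⟩ := exists_crossing
  have hp0 : 0 < p := by linarith
  have lF : ∀ q : ℝ, 0 < q → ∫⁻ x in Ioi (0 : ℝ), ENNReal.ofReal (|sinc x| ^ q) =
      ENNReal.ofReal q * ∫⁻ t in Ioi 0, sincDist t * ENNReal.ofReal (t ^ (q - 1)) := fun q hq =>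
    lintegral_rpow_eq_lintegral_meas_lt_mul _ (Eventually.of_forall fun x => abs_nonneg _)
      (by fun_prop) hq
  have lG : ∀ q : ℝ, 0 < q → ∫⁻ x in Ioi (0 : ℝ), ENNReal.ofReal (exp (-(x ^ 2 / (2 * π))) ^ q) =
      ENNReal.ofReal q * ∫⁻ t in Ioi 0, gaussDist t * ENNReal.ofReal (t ^ (q - 1)) := fun q hq =>
    lintegral_rpow_eq_lintegral_meas_lt_mul _ (Eventually.of_forall fun x => (exp_pos _).le)
      (by fun_prop) hq
  -- At p = 2 both integrals equal π, so by the layer-cake formula the first moments of the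
  -- distribution functions agree.
  have hS := lintegral_sinc_rpow (p := 2) (by norm_num)
  have hG := lintegral_gauss_rpow (p := 2) (by norm_num)
  rw [lF 2 two_pos] at hS
  rw [lG 2 two_pos] at hG
  have hsq : ∫ x, |sinc x| ^ (2 : ℝ) = π := by
    rw [← integral_sinc_sq]; simp
  rw [hsq] at hS
  rw [div_self two_ne_zero, sqrt_one, mul_one, hS] at hG
  have h21 : (2 : ℝ) - 1 = 1 := by norm_num
  simp only [h21, rpow_one] at hS hG
  have h2ne : (2 : ENNReal) * ENNReal.ofReal 2 ≠ 0 := by simp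
  have h2nt : (2 : ENNReal) * ENNReal.ofReal 2 ≠ ⊤ := ENNReal.mul_ne_top (by simp) (by simp)
  rw [← mul_assoc, ← mul_assoc] at hG
  have heq := (ENNReal.mul_right_inj h2ne h2nt).1 hG
  have hfin : ∫⁻ t in Ioi 0, gaussDist t * ENNReal.ofReal t ≠ ⊤ := by
    intro h
    rw [heq] at h
    rw [h, ← mul_assoc, ENNReal.mul_top h2ne] at hS
    exact ENNReal.ofReal_ne_top hS
  have hmain := lintegral_rpow_le_of_crossing antitone_sincDist.measurable
    antitone_gaussDist.measurable hy hp h1 h2 heq.ge hfin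
  rw [← ENNReal.ofReal_le_ofReal_iff (by positivity), lintegral_sinc_rpow (by linarith),
    ← lintegral_gauss_rpow hp0, lF p hp0, lG p hp0]
  gcongr

end Main

end BallIntegral

namespace BoxSection

open Set Filter Topology Real

/-! ### Fourier transform of a box -/

section BoxFourier

lemma mem_Icc_iff_abs_le {x a : ℝ} : x ∈ Icc (-a) a ↔ |x| ≤ a := abs_le.symm

variable {ι : Type*}

lemma isCompact_box (a : ι → ℝ) : IsCompact {u : EuclideanSpace ℝ ι | ∀ j, |u j| ≤ a j} := by
  have h : IsCompact (Set.univ.pi fun j => Icc (-a j) (a j)) := isCompact_univ_pi fun j =>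
    isCompact_Icc
  have := h.image (PiLp.continuous_toLp 2 fun _ : ι => ℝ)
  convert! this using 1
  ext u
  constructor
  · intro hu
    exact ⟨WithLp.ofLp u, fun j _ => abs_le.1 (hu j), rfl⟩
  · rintro ⟨v, hv, rfl⟩ j
    exact abs_le.2 (hv j (mem_univ j))

variable [Fintype ι]

/-- The indicator of the box `∏ [-a j, a j]`. -/
noncomputable def boxInd (a : ι → ℝ) (u : EuclideanSpace ℝ ι) : ℂ :=
  ∏ j, (Icc (-a j) (a j)).indicator (fun _ => (1 : ℂ)) (u j)

lemma boxInd_eq (a : ι → ℝ) (u : EuclideanSpace ℝ ι) :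
    boxInd a u = {u : EuclideanSpace ℝ ι | ∀ j, |u j| ≤ a j}.indicator (fun _ => (1 : ℂ)) u := by
  classical
  unfold boxInd
  by_cases h : ∀ j, |u j| ≤ a j
  · rw [indicator_of_mem (show u ∈ {u : EuclideanSpace ℝ ι | ∀ j, |u j| ≤ a j} from h)]
    exact Finset.prod_eq_one fun j _ => indicator_of_mem (mem_Icc_iff_abs_le.2 (h j)) _
  · rw [indicator_of_notMem (show u ∉ {u : EuclideanSpace ℝ ι | ∀ j, |u j| ≤ a j} from h)]
    push Not at h
    obtain ⟨j, hj⟩ := h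
    exact Finset.prod_eq_zero (Finset.mem_univ j)
      (indicator_of_notMem (fun hc => hj.not_ge (mem_Icc_iff_abs_le.1 hc)) _)

lemma integrable_boxInd (a : ι → ℝ) : Integrable (boxInd a) := by
  have : boxInd a = {u : EuclideanSpace ℝ ι | ∀ j, |u j| ≤ a j}.indicator (fun _ => (1 : ℂ)) :=
    funext (boxInd_eq a)
  rw [this, integrable_indicator_iff (isCompact_box a).measurableSet]
  exact integrableOn_const (isCompact_box a).measure_lt_top.ne

lemma integral_exp_mul_indicator {a : ℝ} (ha : 0 < a) (s : ℝ) :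
    ∫ x : ℝ, Complex.exp ((-2 * π * (x * s) : ℝ) * Complex.I) *
      (Icc (-a) a).indicator (fun _ => (1 : ℂ)) x = ((2 * a * sinc (2 * π * a * s) : ℝ) : ℂ) := by
  have h1 : ∀ x : ℝ, Complex.exp ((-2 * π * (x * s) : ℝ) * Complex.I) *
      (Icc (-a) a).indicator (fun _ => (1 : ℂ)) x = (Icc (-a) a).indicator
      (fun x : ℝ => Complex.exp ((-2 * π * (x * s) : ℝ) * Complex.I)) x := fun x => by
    by_cases hx : x ∈ Icc (-a) a <;> simp [hx]
  simp_rw [h1]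
  rw [integral_indicator measurableSet_Icc, integral_Icc_eq_integral_Ioc,
    ← intervalIntegral.integral_of_le (by linarith)]
  rcases eq_or_ne s 0 with rfl | hs
  · simp only [mul_zero, Complex.ofReal_zero, zero_mul, Complex.exp_zero, sinc_zero, mul_one]
    simp
    ring
  · have hc : -2 * π * s ≠ 0 := by simp [pi_ne_zero, hs]
    have h2 := intervalIntegral.integral_comp_mul_left
      (a := -a) (b := a) (fun t : ℝ => Complex.exp (t * Complex.I)) hc
    have h3 := integral_exp_mul_I_eq_sinc (-2 * π * s * a)
    rw [show -2 * π * s * -a = -(-2 * π * s * a) by ring, h3] at h2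
    have h4 : ∀ x : ℝ, -2 * π * (x * s) = -2 * π * s * x := fun x => by ring
    simp_rw [h4]
    rw [h2, show -2 * π * s * a = -(2 * π * a * s) by ring, sinc_neg, Complex.real_smul]
    push_cast
    have hs' : (s : ℂ) ≠ 0 := by exact_mod_cast hs
    have hp' : (π : ℂ) ≠ 0 := by exact_mod_cast pi_ne_zero
    field_simp

lemma integral_exp_mul_boxInd {a : ι → ℝ} (ha : ∀ j, 0 < a j) (y : EuclideanSpace ℝ ι) :
    ∫ u : EuclideanSpace ℝ ι, Complex.exp ((-2 * π * inner ℝ u y : ℝ) * Complex.I) * boxInd a u =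
      ((∏ j, (2 * a j * sinc (2 * π * a j * y j)) : ℝ) : ℂ) := by
  have h1 : ∀ u : EuclideanSpace ℝ ι,
      Complex.exp ((-2 * π * inner ℝ u y : ℝ) * Complex.I) * boxInd a u =
      ∏ j, (Complex.exp ((-2 * π * (u j * y j) : ℝ) * Complex.I) *
        (Icc (-a j) (a j)).indicator (fun _ => (1 : ℂ)) (u j)) := fun u => by
    rw [Finset.prod_mul_distrib, ← Complex.exp_sum, boxInd]
    congr 2
    rw [PiLp.inner_apply, ← Finset.sum_mul, ← Complex.ofReal_sum, Finset.mul_sum]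
    congr 3
    funext j
    simp [mul_comm]
  simp_rw [h1]
  have h2 := (PiLp.volume_preserving_toLp ι).integral_comp
    (MeasurableEquiv.toLp 2 (ι → ℝ)).measurableEmbedding
    (fun u : EuclideanSpace ℝ ι => ∏ j, (Complex.exp ((-2 * π * (u j * y j) : ℝ) * Complex.I) *
        (Icc (-a j) (a j)).indicator (fun _ => (1 : ℂ)) (u j)))
  rw [← h2]
  have h3 := integral_fintype_prod_volume_eq_prod (fun (j : ι) (t : ℝ) =>
    Complex.exp ((-2 * π * (t * y j) : ℝ) * Complex.I) *
        (Icc (-a j) (a j)).indicator (fun _ => (1 : ℂ)) t)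
  refine h3.trans ?_
  rw [Complex.ofReal_prod]
  exact Finset.prod_congr rfl fun j _ => integral_exp_mul_indicator (ha j) (y j)

lemma continuousAt_boxInd {a : ι → ℝ} {u : EuclideanSpace ℝ ι} (hu : ∀ j, |u j| ≠ a j) :
    ContinuousAt (boxInd a) u := by
  unfold boxInd
  refine tendsto_finsetProd _ fun j _ => ?_
  have hc : ContinuousAt (fun v : EuclideanSpace ℝ ι => |v j|) u := by fun_prop
  refine tendsto_const_nhds.congr' ?_
  rcases lt_or_gt_of_ne (hu j) with h | h
  · filter_upwards [hc.eventually_lt_const h] with v hv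
    rw [indicator_of_mem (mem_Icc_iff_abs_le.2 h.le), indicator_of_mem (mem_Icc_iff_abs_le.2 hv.le)]
  · filter_upwards [hc.eventually_const_lt h] with v hv
    rw [indicator_of_notMem fun hm => h.not_ge (mem_Icc_iff_abs_le.1 hm),
      indicator_of_notMem fun hm => hv.not_ge (mem_Icc_iff_abs_le.1 hm)]

end BoxFourier

/-! ### Sections of a box by a subspace -/

section Slicing

variable {ι : Type*} [Fintype ι] (S : Submodule ℝ (EuclideanSpace ℝ ι))

lemma measurePreserving_add :
    MeasurePreserving (fun q : S × Sᗮ => (q.1 : EuclideanSpace ℝ ι) + q.2) := by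
  have h := (S.orthogonalDecomposition.symm.measurePreserving).comp
    (WithLp.volume_preserving_toLp S Sᗮ)
  convert! h using 1

lemma measurableEmbedding_add :
    MeasurableEmbedding (fun q : S × Sᗮ => (q.1 : EuclideanSpace ℝ ι) + q.2) := by
  have h := (S.orthogonalDecomposition.symm.toHomeomorph.measurableEmbedding).comp
    (MeasurableEquiv.toLp 2 (S × Sᗮ)).measurableEmbedding
  convert! h using 1

/-- The volume of the parallel sections of the box, as a function on the orthogonal complement. -/
noncomputable def sectionVol (a : ι → ℝ) (z : Sᗮ) : ℂ :=
  ∫ x : S, boxInd a ((x : EuclideanSpace ℝ ι) + z)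

lemma integrable_boxInd_add (a : ι → ℝ) :
    Integrable (fun q : S × Sᗮ => boxInd a ((q.1 : EuclideanSpace ℝ ι) + q.2))
      ((volume : Measure S).prod volume) :=
  ((measurePreserving_add S).integrable_comp_emb (measurableEmbedding_add S)).2
    (integrable_boxInd a)

lemma integrable_sectionVol (a : ι → ℝ) : Integrable (sectionVol S a) :=
  (integrable_boxInd_add S a).integral_prod_right

/-- For y ∈ Sᗮ the phase depends only on the Sᗮ-component, so Fubini turns the transform of the box
at y into that of the section function. -/
lemma fourier_sectionVol {a : ι → ℝ} (ha : ∀ j, 0 < a j) (y : Sᗮ) :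
    FourierTransform.fourier (sectionVol S a) y =
      ((∏ j, (2 * a j * sinc (2 * π * a j * (y : EuclideanSpace ℝ ι) j)) : ℝ) : ℂ) := by
  rw [← integral_exp_mul_boxInd ha (y : EuclideanSpace ℝ ι), Real.fourier_eq',
    ← (measurePreserving_add S).integral_comp (measurableEmbedding_add S)]
  have hint : Integrable (fun q : S × Sᗮ => Complex.exp ((-2 * π *
      inner ℝ ((q.1 : EuclideanSpace ℝ ι) + q.2) (y : EuclideanSpace ℝ ι) : ℝ) * Complex.I) *
      boxInd a ((q.1 : EuclideanSpace ℝ ι) + q.2)) ((volume : Measure S).prod volume) := by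
    refine (integrable_boxInd_add S a).bdd_mul (c := 1) ?_ (Eventually.of_forall fun q => ?_)
    · exact Continuous.aestronglyMeasurable (by fun_prop)
    · rw [Complex.norm_exp_ofReal_mul_I]
  rw [Measure.volume_eq_prod, integral_prod_symm _ hint]
  refine integral_congr_ae (Eventually.of_forall fun z => ?_)
  simp only [sectionVol, smul_eq_mul]
  rw [← integral_const_mul]
  refine integral_congr_ae (Eventually.of_forall fun x => ?_)
  simp only
  rw [inner_add_left, S.inner_right_of_mem_orthogonal x.2 y.2, zero_add]
  rfl

lemma volume_level_eq_zero {V : Type*} [NormedAddCommGroup V] [InnerProductSpace ℝ V]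
    [FiniteDimensional ℝ V] [MeasurableSpace V] [BorelSpace V] {w : V} (hw : w ≠ 0) (c : ℝ) :
    volume {x : V | inner ℝ w x = c} = 0 := by
  set x₀ : V := (c / ‖w‖ ^ 2) • w
  set A : AffineSubspace ℝ V := AffineSubspace.mk' x₀ (LinearMap.ker (innerSL ℝ w).toLinearMap)
  have hn : ‖w‖ ^ 2 ≠ 0 := by positivity
  have hx₀ : inner ℝ w x₀ = c := by
    rw [inner_smul_right, real_inner_self_eq_norm_sq, div_mul_cancel₀ _ hn]
  have hA : {x : V | inner ℝ w x = c} = A := by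
    ext x
    simp only [mem_ofPred_eq, A, SetLike.mem_coe, AffineSubspace.mem_mk', vsub_eq_sub,
      LinearMap.mem_ker, ContinuousLinearMap.coe_coe, innerSL_apply_apply, inner_sub_right, hx₀, sub_eq_zero]
  rw [hA]
  refine Measure.addHaar_affineSubspace _ _ fun h => ?_
  have h1 : x₀ + w ∈ {x : V | inner ℝ w x = c} := by rw [hA, h]; trivial
  rw [mem_ofPred_eq, inner_add_right, hx₀, real_inner_self_eq_norm_sq] at h1
  exact hn (by linarith)

/-- Dominated convergence. By `hS` no coordinate vanishes identically on S, so the hyperplanes |x j|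
= a j, the only places where the indicator can jump, are null in S. -/
lemma continuousAt_sectionVol (a : ι → ℝ)
    (hS : ∀ j, S.orthogonalProjectionOnto (EuclideanSpace.basisFun ι ℝ j) ≠ 0) :
    ContinuousAt (sectionVol S a) 0 := by
  obtain ⟨R, hR⟩ := (isCompact_box a).isBounded.subset_closedBall 0
  have hmeas : Measurable (boxInd a) := by
    unfold boxInd
    refine Finset.measurable_prod _ fun j _ => ?_
    exact (measurable_const.indicator measurableSet_Icc).comp (by fun_prop)
  refine continuousAt_of_dominated (bound := (Metric.closedBall (0 : S) R).indicator fun _ => 1)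
    ?_ ?_ ?_ ?_
  · exact Eventually.of_forall fun z => (hmeas.comp (by fun_prop)).aestronglyMeasurable
  · refine Eventually.of_forall fun z => Eventually.of_forall fun x => ?_
    rw [boxInd_eq]
    by_cases h : (x : EuclideanSpace ℝ ι) + z ∈ {u : EuclideanSpace ℝ ι | ∀ j, |u j| ≤ a j}
    · have hx : x ∈ Metric.closedBall (0 : S) R := by
        have h1 := hR h
        rw [mem_closedBall_zero_iff] at h1 ⊢
        refine le_trans ?_ h1
        have h2 := norm_add_sq_eq_norm_sq_add_norm_sq_of_inner_eq_zero (x : EuclideanSpace ℝ ι) z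
          (S.inner_right_of_mem_orthogonal x.2 z.2)
        rw [Submodule.coe_norm]
        nlinarith [norm_nonneg (x : EuclideanSpace ℝ ι), norm_nonneg (z : EuclideanSpace ℝ ι),
          norm_nonneg ((x : EuclideanSpace ℝ ι) + z)]
      rw [indicator_of_mem h, indicator_of_mem hx]
      simp
    · rw [indicator_of_notMem h, norm_zero]
      exact indicator_nonneg (fun _ _ => zero_le_one) _
  · rw [integrable_indicator_iff Metric.isClosed_closedBall.measurableSet]
    exact integrableOn_const (isCompact_closedBall _ _).measure_lt_top.ne
  · have hae : ∀ᵐ x : S, ∀ j, |(x : EuclideanSpace ℝ ι) j| ≠ a j := by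
      rw [ae_all_iff]
      intro j
      have hin : ∀ x : S, (x : EuclideanSpace ℝ ι) j =
          inner ℝ (S.orthogonalProjectionOnto (EuclideanSpace.basisFun ι ℝ j)) x := fun x => by
        rw [Submodule.inner_orthogonalProjectionOnto_eq_of_mem_right, EuclideanSpace.basisFun_inner]
      have h1 := volume_level_eq_zero (hS j) (a j)
      have h2 := volume_level_eq_zero (hS j) (-a j)
      refine measure_mono_null (t := _ ∪ _) (fun x hx => ?_) (measure_union_null h1 h2)
      have hx' : |(x : EuclideanSpace ℝ ι) j| = a j := not_not.1 hx
      have := abs_choice ((x : EuclideanSpace ℝ ι) j)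
      rw [hx'] at this
      rcases this with h | h
      · exact Or.inl (by rw [mem_ofPred_eq, ← hin, h])
      · exact Or.inr (by rw [mem_ofPred_eq, ← hin, h, neg_neg])
    filter_upwards [hae] with x hx
    have h0 : ContinuousAt (boxInd a) ((x : EuclideanSpace ℝ ι) + (0 : Sᗮ)) := by
      simpa using continuousAt_boxInd hx
    exact h0.comp (f := fun z : Sᗮ => (x : EuclideanSpace ℝ ι) + z) (by fun_prop)

lemma sectionVol_zero (a : ι → ℝ) :
    sectionVol S a 0 = (volume.real {x : S | ∀ j, |(x : EuclideanSpace ℝ ι) j| ≤ a j} : ℂ) := by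
  have h : ∀ x : S, boxInd a ((x : EuclideanSpace ℝ ι) + (0 : Sᗮ)) =
      {x : S | ∀ j, |(x : EuclideanSpace ℝ ι) j| ≤ a j}.indicator (fun _ => (1 : ℂ)) x := fun x => by
    rw [boxInd_eq]
    simp [indicator]
  have hm : MeasurableSet {x : S | ∀ j, |(x : EuclideanSpace ℝ ι) j| ≤ a j} :=
    ((isCompact_box a).measurableSet).preimage measurable_subtype_coe
  simp only [sectionVol, h]
  rw [integral_indicator hm]
  simp

/-- The density attached to one coordinate when applying the Brascamp-Lieb inequality. -/
noncomputable def coordDensity (d a s : ℝ) : ℝ :=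
  open Classical in
  -- At d = 0 the density enters only as a 0-th power, so any positive integrable function serves;
  -- the other branch would be the constant 1, which is not integrable.
  if d = 0 then exp (-1 * s ^ 2) else |sinc (2 * π * a * √d * s)| ^ (1 / d)

lemma continuous_coordDensity {d a : ℝ} (hd : 0 ≤ d) : Continuous (coordDensity d a) := by
  unfold coordDensity
  split_ifs with h
  · fun_prop
  · exact (continuous_sinc.comp (by fun_prop)).abs.rpow_const fun _ =>
      Or.inr (one_div_nonneg.2 hd)

lemma integrable_coordDensity {d a : ℝ} (hd : 0 ≤ d) (hd1 : d < 1) (ha : 0 < a) :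
    Integrable (coordDensity d a) := by
  unfold coordDensity
  split_ifs with h
  · exact integrable_exp_neg_mul_sq one_pos
  · have hd0 : 0 < d := lt_of_le_of_ne hd (Ne.symm h)
    have hc : 2 * π * a * √d ≠ 0 := by
      have := pi_pos
      have := sqrt_pos.2 hd0
      positivity
    exact (BallIntegral.integrable_abs_sinc_rpow ((one_lt_div hd0).2 hd1)).comp_mul_left' hc

lemma integral_coordDensity_rpow {d a : ℝ} (hd : 0 ≤ d) (ha : 0 < a) :
    (∫ s, coordDensity d a s) ^ d =
      ((∫ s, |sinc s| ^ (1 / d)) / (2 * π * a * √d)) ^ d := by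
  rcases hd.eq_or_lt with rfl | hd0
  · simp
  · have := pi_pos
    have hc : 0 < 2 * π * a * √d := by
      have := sqrt_pos.2 hd0
      positivity
    unfold coordDensity
    simp only [hd0.ne', if_false]
    rw [Measure.integral_comp_mul_left (fun s => |sinc s| ^ (1 / d)),
      abs_of_pos (inv_pos.2 hc), smul_eq_mul, inv_mul_eq_div]

/-- A section of a box by a subspace is bounded by a product of sinc integrals. -/
theorem volume_section_le {a : ι → ℝ} (ha : ∀ j, 0 < a j)
    (hS : ∀ j, S.orthogonalProjectionOnto (EuclideanSpace.basisFun ι ℝ j) ≠ 0) {d : ι → ℝ}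
    (hd : ∀ j, d j = 1 - ‖S.orthogonalProjectionOnto (EuclideanSpace.basisFun ι ℝ j)‖ ^ 2) :
    volume {x : S | ∀ j, |(x : EuclideanSpace ℝ ι) j| ≤ a j} ≤
      ENNReal.ofReal (∏ j, (2 * a j * ((∫ s, |sinc s| ^ (1 / d j)) /
        (2 * π * a j * √(d j))) ^ d j)) := by
  set e := EuclideanSpace.basisFun ι ℝ
  set q : ι → Sᗮ := fun j => Sᗮ.orthogonalProjectionOnto (e j) with hq
  have hdq : ∀ j, d j = ‖q j‖ ^ 2 := fun j => by
    have := Submodule.norm_sq_eq_add_norm_sq_projection (e j) S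
    rw [e.orthonormal.1 j] at this
    rw [hd j]
    linarith
  have hd0 : ∀ j, 0 ≤ d j := fun j => by rw [hdq]; positivity
  have hd1 : ∀ j, d j < 1 := fun j => by
    have := norm_pos_iff.2 (hS j)
    rw [hd j]; nlinarith
  have hin : ∀ j (y : Sᗮ), inner ℝ (q j) y = (y : EuclideanSpace ℝ ι) j := fun j y => by
    rw [hq, Submodule.inner_orthogonalProjectionOnto_eq_of_mem_right, EuclideanSpace.basisFun_inner]
  have hq0 : ∀ j, d j = 0 → q j = 0 := fun j hj => by
    rw [hdq] at hj; simpa using hj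
  -- If `d j = 0` then `q j = 0`, and the convention 0⁻¹ = 0 makes `u j = 0`, which `hun` allows.
  obtain ⟨u, hqu⟩ : ∃ u : ι → Sᗮ, ∀ j, √(d j) • u j = q j := by
    refine ⟨fun j => (√(d j))⁻¹ • q j, fun j => ?_⟩
    rcases (hd0 j).eq_or_lt with h | h
    · rw [hq0 j h.symm, ← h]; simp
    · rw [smul_smul, mul_inv_cancel₀ (sqrt_pos.2 h).ne', one_smul]
  have hun : ∀ j, d j * ‖u j‖ ^ 2 = d j := fun j => by
    have h1 : d j = √(d j) ^ 2 := (sq_sqrt (hd0 j)).symm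
    have h2 : ‖√(d j) • u j‖ ^ 2 = d j := by rw [hqu, hdq]
    rw [norm_smul, mul_pow, norm_of_nonneg (sqrt_nonneg _), ← h1] at h2
    exact h2
  have hid : ∀ y : Sᗮ, ∑ j, (d j * inner ℝ (u j) y) • u j = y := by
    intro y
    have h1 : ∀ j, (d j * inner ℝ (u j) y) • u j = ((y : EuclideanSpace ℝ ι) j) • q j := fun j => by
      rw [← hin, ← hqu j, inner_smul_left, smul_smul, conj_trivial]
      congr 1
      nth_rw 1 [← mul_self_sqrt (hd0 j)]
      ring
    simp_rw [h1]
    have h2 := e.sum_repr (y : EuclideanSpace ℝ ι)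
    have h3 := congrArg Sᗮ.orthogonalProjectionOnto h2
    rw [map_sum, Submodule.orthogonalProjectionOnto_mem_subspace_eq_self] at h3
    refine Eq.trans ?_ h3
    refine Finset.sum_congr rfl fun j _ => ?_
    rw [map_smul]
    rfl
  have hBL := BrascampLieb.lintegral_prod_rpow_le hd0 hun hid
    (f := fun j => coordDensity (d j) (a j)) (fun j => continuous_coordDensity (hd0 j))
    (fun j => integrable_coordDensity (hd0 j) (hd1 j) (ha j))
    (fun j s => by unfold coordDensity; split_ifs <;> positivity)
  have hf : ∀ j (y : Sᗮ), coordDensity (d j) (a j) (inner ℝ (u j) y) ^ d j =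
      |sinc (2 * π * a j * (y : EuclideanSpace ℝ ι) j)| := by
    intro j y
    have h1 : √(d j) * inner ℝ (u j) y = (y : EuclideanSpace ℝ ι) j := by
      rw [← hin, ← hqu j, inner_smul_left, conj_trivial]
    rw [← h1, ← mul_assoc]
    rcases (hd0 j).eq_or_lt with h | h
    · rw [← h]; simp
    · simp only [coordDensity, h.ne', if_false]
      rw [← rpow_mul (abs_nonneg _), one_div_mul_cancel h.ne', rpow_one]
  simp_rw [hf] at hBL
  simp_rw [fun j => integral_coordDensity_rpow (hd0 j) (ha j)] at hBL
  have hF : ∀ y : Sᗮ, ‖FourierTransform.fourier (sectionVol S a) y‖ₑ =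
      ENNReal.ofReal (∏ j, 2 * a j) *
        ENNReal.ofReal (∏ j, |sinc (2 * π * a j * (y : EuclideanSpace ℝ ι) j)|) := by
    intro y
    have hpos : 0 ≤ ∏ j, 2 * a j := Finset.prod_nonneg fun j _ => by have := ha j; positivity
    rw [fourier_sectionVol S ha, ← ofReal_norm, Complex.norm_real, norm_eq_abs,
      Finset.prod_mul_distrib, abs_mul, Finset.abs_prod (s := Finset.univ)
        (f := fun j => sinc (2 * π * a j * (y : EuclideanSpace ℝ ι) j)), abs_of_nonneg hpos,
      ENNReal.ofReal_mul hpos]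
  have hle : ∫⁻ y : Sᗮ, ‖FourierTransform.fourier (sectionVol S a) y‖ₑ ≤
      ENNReal.ofReal (∏ j, (2 * a j * ((∫ s, |sinc s| ^ (1 / d j)) /
        (2 * π * a j * √(d j))) ^ d j)) := by
    simp_rw [hF]
    rw [lintegral_const_mul' _ _ ENNReal.ofReal_ne_top,
      Finset.prod_mul_distrib (f := fun j => 2 * a j),
      ENNReal.ofReal_mul (Finset.prod_nonneg fun j _ => by have := ha j; positivity)]
    gcongr
  -- The Brascamp-Lieb bound also supplies the integrability that inversion requires.
  have hint : Integrable (FourierTransform.fourier (sectionVol S a)) := by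
    refine ⟨?_, hle.trans_lt ENNReal.ofReal_lt_top⟩
    have : FourierTransform.fourier (sectionVol S a) = fun y : Sᗮ =>
      ((∏ j, (2 * a j * sinc (2 * π * a j * (y : EuclideanSpace ℝ ι) j)) : ℝ) : ℂ) :=
      funext fun y => fourier_sectionVol S ha y
    rw [this]
    refine Continuous.aestronglyMeasurable ?_
    refine Complex.continuous_ofReal.comp (continuous_finsetProd _ fun j _ => ?_)
    exact continuous_const.mul (continuous_sinc.comp (by fun_prop))
  have hinv := (integrable_sectionVol S a).fourierInv_fourier_eq hint
    (continuousAt_sectionVol S a hS)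
  rw [Real.fourierInv_eq', sectionVol_zero] at hinv
  simp only [inner_zero_right, mul_zero, Complex.ofReal_zero, zero_mul, Complex.exp_zero,
    one_smul] at hinv
  have hfin : volume {x : S | ∀ j, |(x : EuclideanSpace ℝ ι) j| ≤ a j} ≠ ⊤ := by
    have hc : IsCompact {x : S | ∀ j, |(x : EuclideanSpace ℝ ι) j| ≤ a j} :=
      (S.closed_of_finiteDimensional.isClosedEmbedding_subtypeVal).isCompact_preimage
        (isCompact_box a)
    exact hc.measure_lt_top.ne
  calc volume {x : S | ∀ j, |(x : EuclideanSpace ℝ ι) j| ≤ a j}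
      = ‖((volume.real {x : S | ∀ j, |(x : EuclideanSpace ℝ ι) j| ≤ a j} : ℝ) : ℂ)‖ₑ := by
        rw [← ofReal_norm, Complex.norm_real, norm_of_nonneg measureReal_nonneg,
          measureReal_def, ENNReal.ofReal_toReal hfin]
    _ ≤ _ := by
        rw [← hinv]
        exact (enorm_integral_le_lintegral_enorm _).trans hle

end Slicing

end BoxSection

namespace JohnSection

open Set Filter Topology Real

/-! ### Parseval frames and symmetric polytopes -/

section Frame

variable {ι V : Type*} [Fintype ι] [NormedAddCommGroup V] [InnerProductSpace ℝ V]

/-- The isometric embedding attached to a Parseval frame. -/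
noncomputable def frameEmbedding (w : ι → V) (hid : ∀ x, ∑ j, inner ℝ (w j) x • w j = x) :
    V →ₗᵢ[ℝ] EuclideanSpace ℝ ι where
  toFun x := WithLp.toLp 2 fun j => inner ℝ (w j) x
  map_add' x y := by ext j; simp [inner_add_right]
  map_smul' r x := by ext j; simp [inner_smul_right]
  norm_map' x := by
    have h := BrascampLieb.sum_mul_inner_sq (d := fun _ => 1) (u := w) (by simpa using hid) x
    rw [← sq_eq_sq₀ (norm_nonneg _) (norm_nonneg _), EuclideanSpace.norm_sq_eq, ← h]
    simp

lemma sum_norm_sq_eq_finrank [FiniteDimensional ℝ V] (w : ι → V) (hid : ∀ x, ∑ j, inner ℝ (w j) x • w j = x) :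
    ∑ j, ‖w j‖ ^ 2 = Module.finrank ℝ V := by
  set b := stdOrthonormalBasis ℝ V
  have h1 : ∀ j, ‖w j‖ ^ 2 = ∑ i, inner ℝ (w j) (b i) ^ 2 := fun j =>
    (b.sum_sq_inner_left (w j)).symm
  simp_rw [h1]
  rw [Finset.sum_comm]
  have h2 : ∀ i, ∑ j, inner ℝ (w j) (b i) ^ 2 = (1 : ℝ) := fun i => by
    have h := BrascampLieb.sum_mul_inner_sq (d := fun _ => 1) (u := w) (by simpa using hid) (b i)
    simpa using h
  simp [h2]

/-- Parseval's identity at `w j` contains the term ‖w j‖⁴, so ‖w j‖⁴ ≤ ‖w j‖². -/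
lemma norm_sq_le_one (w : ι → V) (hid : ∀ x, ∑ j, inner ℝ (w j) x • w j = x) (j : ι) :
    ‖w j‖ ^ 2 ≤ 1 := by
  have h := BrascampLieb.sum_mul_inner_sq (d := fun _ => 1) (u := w) (by simpa using hid) (w j)
  have h1 := Finset.single_le_sum (f := fun i => 1 * inner ℝ (w i) (w j) ^ 2)
    (fun i _ => by positivity) (Finset.mem_univ j)
  rw [h, real_inner_self_eq_norm_sq, one_mul] at h1
  by_contra! hc
  nlinarith

variable [FiniteDimensional ℝ V] [MeasurableSpace V] [BorelSpace V]

/-- Volume bound for a symmetric polytope whose normals form a Parseval frame. -/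
theorem volume_slabs_le (w : ι → V) (hid : ∀ x, ∑ j, inner ℝ (w j) x • w j = x)
    (hw : ∀ j, w j ≠ 0) {a : ι → ℝ} (ha : ∀ j, 0 < a j) :
    volume {x : V | ∀ j, |inner ℝ (w j) x| ≤ a j} ≤
      ENNReal.ofReal (∏ j, (2 * a j * ((∫ s, |sinc s| ^ (1 / (1 - ‖w j‖ ^ 2))) /
        (2 * π * a j * √(1 - ‖w j‖ ^ 2))) ^ (1 - ‖w j‖ ^ 2))) := by
  set Φ := frameEmbedding w hid
  set S := LinearMap.range Φ.toLinearMap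
  -- Both vectors pair with Φ x to ⟨w j, x⟩.
  have hproj : ∀ j, S.orthogonalProjectionOnto (EuclideanSpace.basisFun ι ℝ j) =
      Φ.equivRange (w j) := by
    intro j
    refine ext_inner_right ℝ fun y => ?_
    obtain ⟨x, rfl⟩ := Φ.equivRange.surjective y
    rw [LinearIsometryEquiv.inner_map_map, Submodule.inner_orthogonalProjectionOnto_eq_of_mem_right,
      EuclideanSpace.basisFun_inner]
    rfl
  have hS : ∀ j, S.orthogonalProjectionOnto (EuclideanSpace.basisFun ι ℝ j) ≠ 0 := fun j => by
    rw [hproj, Ne, LinearIsometryEquiv.map_eq_zero_iff]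
    exact hw j
  have hd : ∀ j, 1 - ‖w j‖ ^ 2 =
      1 - ‖S.orthogonalProjectionOnto (EuclideanSpace.basisFun ι ℝ j)‖ ^ 2 := fun j => by
    rw [hproj, LinearIsometryEquiv.norm_map]
  have h := BoxSection.volume_section_le S ha hS hd
  have hm := Φ.equivRange.measurePreserving.measure_preimage_emb
    Φ.equivRange.toHomeomorph.measurableEmbedding {x : S | ∀ j, |(x : EuclideanSpace ℝ ι) j| ≤ a j}
  exact (Eq.trans rfl hm).trans_le h

end Frame

/-! ### One-dimensional constants -/

section Constants

lemma sincIntegral_eq (p : ℝ) : sincIntegral p = ∫ x, |sinc x| ^ p := by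
  have h0 : ∀ᵐ x : ℝ, x ≠ 0 := by simp [ae_iff, measure_singleton]
  refine integral_congr_ae ?_
  filter_upwards [h0] with x hx
  rw [sinc_of_ne_zero hx]

lemma sincIntegral_nonneg (p : ℝ) : 0 ≤ sincIntegral p :=
  integral_nonneg fun _ => rpow_nonneg (abs_nonneg _) _

lemma sincFactor_one : sincFactor 1 = 1 := if_pos rfl

lemma sincFactor_of_lt {t : ℝ} (ht : t < 1) :
    sincFactor t = (1 - t) ^ (-((1 - t) / 2)) * sincIntegral (1 / (1 - t)) ^ (1 - t) := by
  have h : (1 - t) ≠ 0 := by linarith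
  simp only [sincFactor, ht.ne, if_false]
  congr 2
  · field_simp
  · simp

lemma sincFactor_nonneg {t : ℝ} (ht : t ≤ 1) : 0 ≤ sincFactor t := by
  rcases ht.eq_or_lt with rfl | h
  · rw [sincFactor_one]; exact zero_le_one
  · rw [sincFactor_of_lt h]
    exact mul_nonneg (rpow_nonneg (by linarith) _) (rpow_nonneg (sincIntegral_nonneg _) _)

/-- Powers of 2 and π are isolated so that ∑ t = k and ∑ (1 - t) = m₀ - k can be used after
multiplying over j. At t = 1 the exponent 1 - t is 0 and both sides are 2a. -/
lemma coord_factor_eq {t a : ℝ} (ht : t ≤ 1) (ha : 0 < a) :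
    2 * a * ((∫ s, |sinc s| ^ (1 / (1 - t))) / (2 * π * a * √(1 - t))) ^ (1 - t) =
      2 ^ t * π ^ (-(1 - t)) * (sincFactor t * a ^ t) := by
  rw [← sincIntegral_eq]
  have hp := pi_pos
  rcases ht.eq_or_lt with rfl | h
  · simp [sincFactor_one]
  · rw [sincFactor_of_lt h]
    set d := 1 - t with hd
    have hd0 : 0 < d := by linarith
    have htd : t = 1 - d := by linarith
    clear_value d
    subst htd
    rw [div_rpow (sincIntegral_nonneg _) (by positivity), mul_rpow (by positivity) (by positivity),
      mul_rpow (by positivity) ha.le, mul_rpow (by norm_num) hp.le, rpow_sub two_pos,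
      rpow_sub ha, rpow_one, rpow_one, rpow_neg hp.le, rpow_neg hd0.le, sqrt_eq_rpow,
      ← rpow_mul hd0.le, show 1 / 2 * d = d / 2 by ring]
    have h1 : (2 : ℝ) ^ d ≠ 0 := by positivity
    have h2 : π ^ d ≠ 0 := by positivity
    have h3 : a ^ d ≠ 0 := by positivity
    have h4 : d ^ (d / 2) ≠ 0 := by positivity
    field_simp

/-- With d = 1 - t ≤ 1/2 Ball's inequality applies at p = 1/d, and its factor d^(d/2) cancels
d^(-d/2). -/
lemma sincFactor_le {t : ℝ} (ht : 1 / 2 ≤ t) (ht1 : t ≤ 1) :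
    sincFactor t ≤ π ^ (1 - t) * 2 ^ ((1 - t) / 2) := by
  have hp := pi_pos
  rcases ht1.eq_or_lt with rfl | h
  · simp [sincFactor_one]
  · rw [sincFactor_of_lt h]
    set d := 1 - t with hd
    have hd0 : 0 < d := by linarith
    have hI : sincIntegral (1 / d) ≤ π * √(2 * d) := by
      rw [sincIntegral_eq]
      have := BallIntegral.integral_abs_sinc_rpow_le (p := 1 / d)
        (by rw [le_div_iff₀ hd0]; linarith)
      simpa using this
    calc d ^ (-(d / 2)) * sincIntegral (1 / d) ^ d
        ≤ d ^ (-(d / 2)) * (π * √(2 * d)) ^ d := by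
          gcongr
          exact sincIntegral_nonneg _
      _ = π ^ d * 2 ^ (d / 2) := by
          rw [mul_rpow hp.le (by positivity), sqrt_eq_rpow, ← rpow_mul (by positivity),
            show 1 / 2 * d = d / 2 by ring, mul_rpow two_pos.le hd0.le, rpow_neg hd0.le]
          have h4 : d ^ (d / 2) ≠ 0 := by positivity
          field_simp

end Constants

/-! ### Contact points and the frame induced on H -/

section Geometry

/-- A symmetric convex body containing the unit ball lies in the slab determined by any of its
contact points with the sphere. -/
lemma abs_inner_le_one_of_contact {n : ℕ} {K : ConvexBody (Rn n)} (hsymm : ∀ x ∈ K, -x ∈ K)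
    (hball : Metric.closedBall (0 : Rn n) 1 ⊆ (K : Set (Rn n))) {v : Rn n}
    (hv : v ∈ frontier (K : Set (Rn n)) ∩ Metric.sphere (0 : Rn n) 1) {x : Rn n} (hx : x ∈ K) :
    |inner ℝ v x| ≤ 1 := by
  have hint : (0 : Rn n) ∈ interior (K : Set (Rn n)) :=
    interior_mono hball (Metric.ball_subset_interior_closedBall (Metric.mem_ball_self one_pos))
  obtain ⟨f, hf⟩ := geometric_hahn_banach_open_point K.convex.interior isOpen_interior hv.1.2
  have hfK : ∀ y ∈ (K : Set (Rn n)), f y ≤ f v := by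
    intro y hy
    have hy' : y ∈ closure (interior (K : Set (Rn n))) := by
      rw [K.convex.closure_interior_eq_closure_of_nonempty_interior ⟨0, hint⟩]
      exact subset_closure hy
    exact closure_minimal (fun z hz => (hf z hz).le)
      (isClosed_le f.continuous continuous_const) hy'
  set w := (InnerProductSpace.toDual ℝ (Rn n)).symm f
  have hfw : ∀ y, f y = inner ℝ w y := fun y =>
    (InnerProductSpace.toDual_symm_apply (x := y) (y := f)).symm
  have hvn : ‖v‖ = 1 := by simpa using hv.2
  have hw : 0 < ‖w‖ := by
    rw [norm_pos_iff]
    intro h0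
    have := hf 0 hint
    rw [hfw, hfw, h0] at this
    simp at this
  -- The supporting functional is tested at w/‖w‖, which lies in the ball; equality in
  -- Cauchy-Schwarz then forces w = ‖w‖ v.
  have h1 : ‖w‖ ≤ inner ℝ w v := by
    have hmem : ‖w‖⁻¹ • w ∈ (K : Set (Rn n)) := hball (by
      rw [mem_closedBall_zero_iff, norm_smul, norm_inv, norm_norm, inv_mul_cancel₀ hw.ne'])
    have := hfK _ hmem
    rw [hfw, hfw, inner_smul_right, real_inner_self_eq_norm_sq, pow_two,
      inv_mul_cancel_left₀ hw.ne'] at this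
    exact this
  have h2 : inner ℝ w v = ‖w‖ * ‖v‖ := le_antisymm (real_inner_le_norm w v) (by simpa [hvn] using h1)
  have h3 : w = ‖w‖ • v := by
    have := inner_eq_norm_mul_iff_real.1 h2
    simpa [hvn] using this
  have hle : ∀ y ∈ K, inner ℝ v y ≤ 1 := by
    intro y hy
    have h4 := hfK y hy
    rw [hfw, hfw, h2, hvn, h3, inner_smul_left, conj_trivial, norm_smul, norm_norm, hvn] at h4
    nlinarith
  rw [abs_le]
  have h5 := hle _ (hsymm x hx)
  rw [inner_neg_right] at h5
  exact ⟨by linarith, hle x hx⟩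

variable {n m : ℕ} {K : ConvexBody (Rn n)} {c : Fin m → ℝ} {v : Fin m → Rn n}
  {H : Submodule ℝ (Rn n)}

lemma mem_activeIndices {j : Fin m} :
    j ∈ activeIndices H v ↔ H.starProjection (v j) ≠ 0 := by
  simp [activeIndices]

/-- The Parseval frame of `H` induced by a decomposition of the identity. -/
noncomputable def frameVec (H : Submodule ℝ (Rn n)) (c : Fin m → ℝ) (v : Fin m → Rn n)
    (j : activeIndices H v) : H :=
  √(c j) • H.orthogonalProjectionOnto (v j)

lemma inner_frameVec (j : activeIndices H v) (x : H) :
    inner ℝ (frameVec H c v j) x = √(c j) * inner ℝ (v j) (x : Rn n) := by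
  refine (real_inner_smul_left (H.orthogonalProjectionOnto (v j)) x _).trans ?_
  rw [Submodule.inner_orthogonalProjectionOnto_eq_of_mem_right]

lemma frameVec_identity (hdec : IsJohnDecomposition K c v) (x : H) :
    ∑ j, inner ℝ (frameVec H c v j) x • frameVec H c v j = x := by
  have h1 : ∀ j : activeIndices H v, inner ℝ (frameVec H c v j) x • frameVec H c v j =
      (c j * inner ℝ (v j) (x : Rn n)) • H.orthogonalProjectionOnto (v j) := fun j => by
    rw [inner_frameVec, frameVec, smul_smul]
    congr 1
    nth_rw 3 [← mul_self_sqrt (hdec.pos j).le]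
    ring
  simp_rw [h1]
  have h2 := congrArg H.orthogonalProjectionOnto (hdec.identity (x : Rn n))
  rw [map_sum, Submodule.orthogonalProjectionOnto_mem_subspace_eq_self] at h2
  refine Eq.trans ?_ h2
  rw [Finset.sum_coe_sort (activeIndices H v) fun j =>
    (c j * inner ℝ (v j) (x : Rn n)) • H.orthogonalProjectionOnto (v j)]
  refine Eq.trans (Finset.sum_subset (Finset.subset_univ _) fun j _ hj => ?_)
    (Finset.sum_congr rfl fun j _ => ?_)
  · rw [mem_activeIndices, not_not, Submodule.starProjection_apply, ZeroMemClass.coe_eq_zero] at hj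
    rw [hj, smul_zero]
  · rw [map_smul, map_smul, smul_smul]

lemma norm_frameVec_sq (hdec : IsJohnDecomposition K c v) (j : activeIndices H v) :
    ‖frameVec H c v j‖ ^ 2 = cTilde H c v j := by
  rw [frameVec, norm_smul, mul_pow, norm_of_nonneg (sqrt_nonneg _), sq_sqrt (hdec.pos j).le, cTilde]
  rfl

lemma frameVec_ne_zero (hdec : IsJohnDecomposition K c v) (j : activeIndices H v) :
    frameVec H c v j ≠ 0 := by
  have hj := mem_activeIndices.1 j.2
  rw [Submodule.starProjection_apply, Ne, ZeroMemClass.coe_eq_zero] at hj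
  exact smul_ne_zero (sqrt_pos.2 (hdec.pos j)).ne' hj

lemma sqrt_cTilde_mul_tInv (hdec : IsJohnDecomposition K c v) {j : Fin m}
    (hj : j ∈ activeIndices H v) : √(cTilde H c v j) * tInv H v j = √(c j) := by
  have h := norm_pos_iff.2 (mem_activeIndices.1 hj)
  rw [cTilde, tInv, sqrt_mul (hdec.pos j).le, sqrt_sq h.le, mul_one_div, mul_div_cancel_right₀ _ h.ne']

lemma cTilde_le_one (hdec : IsJohnDecomposition K c v) {j : Fin m}
    (hj : j ∈ activeIndices H v) : cTilde H c v j ≤ 1 := by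
  have := norm_sq_le_one (frameVec H c v) (frameVec_identity hdec) ⟨j, hj⟩
  rwa [norm_frameVec_sq hdec] at this

lemma sum_cTilde (hdec : IsJohnDecomposition K c v) :
    ∑ j ∈ activeIndices H v, cTilde H c v j = Module.finrank ℝ H := by
  rw [← sum_norm_sq_eq_finrank (frameVec H c v) (frameVec_identity hdec), ← Finset.sum_coe_sort]
  exact Finset.sum_congr rfl fun j _ => (norm_frameVec_sq hdec j).symm

lemma sum_one_sub_cTilde (hdec : IsJohnDecomposition K c v) :
    ∑ j ∈ activeIndices H v, (1 - cTilde H c v j) =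
      (activeIndices H v).card - (Module.finrank ℝ H : ℝ) := by
  rw [Finset.sum_sub_distrib, sum_cTilde hdec]
  simp

/-- The contact slabs, scaled by √(c j), become |⟨w j, x⟩| ≤ √(c j) on H, and √(c j) = √(c̃ j) t j.
-/
lemma section_measure_le (hsymm : ∀ x ∈ K, -x ∈ K) (hJohn : IsJohnPosition K)
    (hdec : IsJohnDecomposition K c v) :
    Measure.euclideanHausdorffMeasure (Module.finrank ℝ H) ((K : Set (Rn n)) ∩ H) ≤
      ENNReal.ofReal ((2 : ℝ) ^ (Module.finrank ℝ H) /
        π ^ (((activeIndices H v).card : ℝ) - (Module.finrank ℝ H : ℝ)) *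
          ∏ j ∈ activeIndices H v, (sincFactor (cTilde H c v j) *
              (√(cTilde H c v j) * tInv H v j) ^ (cTilde H c v j))) := by
  have himg : (K : Set (Rn n)) ∩ H = Subtype.val '' {x : H | (x : Rn n) ∈ K} := by
    ext x
    constructor
    · rintro ⟨h1, h2⟩
      exact ⟨⟨x, h2⟩, h1, rfl⟩
    · rintro ⟨y, hy, rfl⟩
      exact ⟨hy, y.2⟩
  rw [himg, isometry_subtype_coe.euclideanHausdorffMeasure_image,
    InnerProductSpace.euclideanHausdorffMeasure_eq_volume]
  have hsub : {x : H | (x : Rn n) ∈ K} ⊆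
      {x : H | ∀ j : activeIndices H v, |inner ℝ (frameVec H c v j) x| ≤ √(c j)} := by
    intro x hx j
    have := abs_inner_le_one_of_contact hsymm hJohn.ball_subset (hdec.contact j) hx
    rw [inner_frameVec, abs_mul, abs_of_nonneg (sqrt_nonneg _)]
    exact mul_le_of_le_one_right (sqrt_nonneg _) this
  refine (measure_mono hsub).trans ((volume_slabs_le (frameVec H c v) (frameVec_identity hdec)
    (frameVec_ne_zero hdec) (fun j => sqrt_pos.2 (hdec.pos j))).trans_eq ?_)
  congr 1
  simp_rw [norm_frameVec_sq hdec]
  rw [Finset.prod_coe_sort (activeIndices H v) fun j => 2 * √(c j) *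
    ((∫ s, |sinc s| ^ (1 / (1 - cTilde H c v j))) /
      (2 * π * √(c j) * √(1 - cTilde H c v j))) ^ (1 - cTilde H c v j)]
  rw [Finset.prod_congr rfl fun j hj =>
    coord_factor_eq (cTilde_le_one hdec hj) (sqrt_pos.2 (hdec.pos j)),
    Finset.prod_mul_distrib, Finset.prod_mul_distrib, ← rpow_sum_of_pos two_pos,
    ← rpow_sum_of_pos pi_pos, Finset.sum_neg_distrib, sum_cTilde hdec, sum_one_sub_cTilde hdec,
    rpow_neg pi_pos.le, rpow_natCast, ← div_eq_mul_inv]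
  congr 1
  exact Finset.prod_congr rfl fun j hj => by rw [sqrt_cTilde_mul_tInv hdec hj]

/-- As ∑ (1 - c̃ j) = m₀ - k, the powers of π cancel and 2^k · 2^((m₀ - k)/2) = 2^((m₀ + k)/2). -/
lemma bound_le_of_half_le (hdec : IsJohnDecomposition K c v)
    (h : ∀ j ∈ activeIndices H v, 1 / 2 ≤ cTilde H c v j) :
    (2 : ℝ) ^ (Module.finrank ℝ H) /
        π ^ (((activeIndices H v).card : ℝ) - (Module.finrank ℝ H : ℝ)) *
          ∏ j ∈ activeIndices H v, (sincFactor (cTilde H c v j) *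
              (√(cTilde H c v j) * tInv H v j) ^ (cTilde H c v j)) ≤
      (2 : ℝ) ^ ((((activeIndices H v).card : ℝ) + (Module.finrank ℝ H : ℝ)) / 2) *
            ∏ j ∈ activeIndices H v, c j ^ (c j * ‖H.starProjection (v j)‖ ^ 2 / 2) := by
  have hp := pi_pos
  have h1 : ∏ j ∈ activeIndices H v, (sincFactor (cTilde H c v j) *
      (√(cTilde H c v j) * tInv H v j) ^ (cTilde H c v j)) ≤
      ∏ j ∈ activeIndices H v, (π ^ (1 - cTilde H c v j) * 2 ^ ((1 - cTilde H c v j) / 2) *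
        c j ^ (c j * ‖H.starProjection (v j)‖ ^ 2 / 2)) := by
    refine Finset.prod_le_prod (fun j hj => ?_) fun j hj => ?_
    · rw [sqrt_cTilde_mul_tInv hdec hj]
      exact mul_nonneg (sincFactor_nonneg (cTilde_le_one hdec hj)) (rpow_nonneg (sqrt_nonneg _) _)
    · rw [sqrt_cTilde_mul_tInv hdec hj, sqrt_eq_rpow, ← rpow_mul (hdec.pos j).le,
        show 1 / 2 * cTilde H c v j = c j * ‖H.starProjection (v j)‖ ^ 2 / 2 by rw [cTilde]; ring]
      exact mul_le_mul_of_nonneg_right (sincFactor_le (h j hj) (cTilde_le_one hdec hj))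
        (rpow_nonneg (hdec.pos j).le _)
  rw [Finset.prod_mul_distrib (f := fun j => π ^ (1 - cTilde H c v j) *
      2 ^ ((1 - cTilde H c v j) / 2)), Finset.prod_mul_distrib (f := fun j =>
      π ^ (1 - cTilde H c v j)), ← rpow_sum_of_pos two_pos, ← rpow_sum_of_pos hp, ← Finset.sum_div, sum_one_sub_cTilde hdec] at h1
  set N : ℝ := ((activeIndices H v).card : ℝ)
  set k := Module.finrank ℝ H
  refine (mul_le_mul_of_nonneg_left h1 (by positivity)).trans_eq ?_
  rw [show (N + k) / 2 = k + (N - k) / 2 by ring, rpow_add two_pos, rpow_natCast]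
  have : π ^ (N - k) ≠ 0 := by positivity
  field_simp

end Geometry

end JohnSection

theorem theorem4p6 (n m k : ℕ) (K : ConvexBody (JohnSection.Rn n))
    (hsymm : ∀ x ∈ K, -x ∈ K) (hJohn : JohnSection.IsJohnPosition K)
    (c : Fin m → ℝ) (v : Fin m → JohnSection.Rn n)
    (hdec : JohnSection.IsJohnDecomposition K c v)
    (H : Submodule ℝ (JohnSection.Rn n)) (hH : Module.finrank ℝ H = k) :
    Measure.euclideanHausdorffMeasure k ((K : Set (JohnSection.Rn n)) ∩ H) ≤
      ENNReal.ofReal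
        ((2 : ℝ) ^ k / Real.pi ^ (((JohnSection.activeIndices H v).card : ℝ) - (k : ℝ)) *
          ∏ j ∈ JohnSection.activeIndices H v,
            (JohnSection.sincFactor (JohnSection.cTilde H c v j) *
              (√(JohnSection.cTilde H c v j) * JohnSection.tInv H v j) ^
                (JohnSection.cTilde H c v j))) ∧
    ((∀ j ∈ JohnSection.activeIndices H v, 1 / 2 ≤ JohnSection.cTilde H c v j) →
      Measure.euclideanHausdorffMeasure k ((K : Set (JohnSection.Rn n)) ∩ H) ≤
        ENNReal.ofReal
          ((2 : ℝ) ^ ((((JohnSection.activeIndices H v).card : ℝ) + (k : ℝ)) / 2) *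
            ∏ j ∈ JohnSection.activeIndices H v,
              c j ^ (c j * ‖H.starProjection (v j)‖ ^ 2 / 2))) := by
  subst hH
  have h := JohnSection.section_measure_le (H := H) hsymm hJohn hdec
  exact ⟨h, fun hhalf =>
    h.trans (ENNReal.ofReal_le_ofReal (JohnSection.bound_le_of_half_le hdec hhalf))⟩
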